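/- Let $P(z)=p_nz^n+\cdots+p_0$ be a complex polynomial of degree $n\ge 1$, $p_n\neq 0$, and let $f\not\equiv 0$ be an entire solution of $f''+P(z)f=0$. For $j\in\mathbb{Z}$ put $$\theta_j=\frac{2\pi j-\arg(p_n)}{n+2},\qquad -\pi<\arg(p_n)\le\pi ,$$ so that the critical ray $\arg z=\theta_j$ depends only on $j$ modulo $n+2$. For $\varepsilon>0$ let $W_j(\varepsilon)=\{re^{i\theta}: r>0,\ |\theta-\theta_j|<\varepsilon\}$, and let $S(\theta_j,\theta_{j+1})=\{re^{i\theta}: r>0,\ \theta_j<\theta<\theta_{j+1}\}$. We say that $f$ blows up exponentially on the ray $\arg z=\theta$ if $$\liminf_{r\to\infty} r^{-(n+2)/2}\log|f(re^{i\theta})|>0,$$ and that $f$ decays to zero exponentially on it if $$\liminf_{r\to\infty} r^{-(n+2)/2}\log|f(re^{i\theta})|^{-1}>0$$ (with $\log 0=-\infty$ and $\log 0^{-1}=+\infty$). Then, for every $j\in\mathbb{Z}$: (a) If $f$ blows up exponentially on each ray in the two adjacent sectors $S(\theta_{j-1},\theta_j)$ and $S(\theta_j,\theta_{j+1})$, then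 the critical ray $\arg z=\theta_j$ is non-shortage: for every $\varepsilon>0$, $f$ has infinitely many zeros in $W_j(\varepsilon)$. (b) If $f$ decays to zero exponentially on each ray in the sector $S(\theta_j,\theta_{j+1})$, then both critical rays $\arg z=\theta_j$ and $\arg z=\theta_{j+1}$ are shortage: for every $0<\varepsilon<\frac{2\pi}{n+2}$, $f$ has only finitely many zeros in $W_j(\varepsilon)$ and in $W_{j+1}(\varepsilon)$. -/

import Mathlib

noncomputable section

namespace PolyOsc

/-- `f` is an entire solution of `f'' + P(z) f = 0` which does not vanish identically. -/
structure IsNontrivialSolution (P : Polynomial ℂ) (f : ℂ → ℂ) : Prop where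
  differentiable : Differentiable ℂ f
  equation : ∀ z : ℂ, deriv (deriv f) z + P.eval z * f z = 0
  nontrivial : ∃ z : ℂ, f z ≠ 0

/-- The angle `θ_j = (2πj - arg p_n)/(n+2)` of the `j`-th critical ray, where `p_n` is the leading
coefficient of `P` and `n` its degree. It is defined for all integers `j`; since
`θ_{j+n+2} = θ_j + 2π`, the ray depends only on `j` modulo `n + 2`. -/
def criticalAngle (P : Polynomial ℂ) (j : ℤ) : ℝ :=
  (2 * Real.pi * (j : ℝ) - Complex.arg P.leadingCoeff) / ((P.natDegree : ℝ) + 2)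

/-- The point `r e^{iθ}`. -/
def polarPoint (r θ : ℝ) : ℂ := (r : ℂ) * Complex.exp ((θ : ℂ) * Complex.I)

/-- The sector `W_j(ε) = {z : |arg z - θ_j| < ε}`; the argument is not restricted to its
principal value. -/
def criticalSector (P : Polynomial ℂ) (j : ℤ) (ε : ℝ) : Set ℂ :=
  {z | ∃ r θ : ℝ, 0 < r ∧ |θ - criticalAngle P j| < ε ∧ z = polarPoint r θ}

/-- `f` blows up exponentially on the ray `arg z = θ`:
`liminf r^{-(n+2)/2} log |f(r e^{iθ})| > 0`, in the extended reals, with `log 0 = -∞`. -/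
def BlowsUpOnRay (n : ℕ) (f : ℂ → ℂ) (θ : ℝ) : Prop :=
  0 < Filter.liminf
    (fun r : ℝ => ((r ^ (-(((n : ℝ) + 2) / 2)) : ℝ) : EReal) *
      ENNReal.log ‖f (polarPoint r θ)‖ₑ) Filter.atTop

/-- `f` decays to zero exponentially on the ray `arg z = θ`:
`liminf r^{-(n+2)/2} log (|f(r e^{iθ})|⁻¹) > 0`, in the extended reals, with
`log (0⁻¹) = +∞`. -/
def DecaysOnRay (n : ℕ) (f : ℂ → ℂ) (θ : ℝ) : Prop :=
  0 < Filter.liminf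
    (fun r : ℝ => ((r ^ (-(((n : ℝ) + 2) / 2)) : ℝ) : EReal) *
      ENNReal.log (‖f (polarPoint r θ)‖ₑ)⁻¹) Filter.atTop

/-- `f` blows up exponentially on each ray of the open sector `S(θ_j, θ_{j+1})`. -/
def BlowsUpOnSector (P : Polynomial ℂ) (f : ℂ → ℂ) (j : ℤ) : Prop :=
  ∀ θ ∈ Set.Ioo (criticalAngle P j) (criticalAngle P (j + 1)), BlowsUpOnRay P.natDegree f θ

/-- `f` decays to zero exponentially on each ray of the open sector `S(θ_j, θ_{j+1})`. -/
def DecaysOnSector (P : Polynomial ℂ) (f : ℂ → ℂ) (j : ℤ) : Prop :=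
  ∀ θ ∈ Set.Ioo (criticalAngle P j) (criticalAngle P (j + 1)), DecaysOnRay P.natDegree f θ

/-- The ray `arg z = θ_j` is a shortage ray of `f`, tested with the sector `W_j(ε)`:
only finitely many zeros of `f` lie in `W_j(ε)`. The ray is non-shortage if this fails. -/
def IsShortageRay (P : Polynomial ℂ) (f : ℂ → ℂ) (j : ℤ) (ε : ℝ) : Prop :=
  {z ∈ criticalSector P j ε | f z = 0}.Finite

end PolyOsc

end

noncomputable section

namespace PolyOsc

open Complex Filter Topology ComplexConjugate Polynomial

variable {g g' Q : ℂ → ℂ} {P : ℂ[X]} {f : ℂ → ℂ}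

/-! The substitution `z = C w ^ (2 / (n + 2))` with a power weight (Liouville transform) turns `f''
+ P f = 0` into `g'' = -Q g` with `Q → 1` at infinity on the slit plane. The critical ray becomes
the positive real axis and the two adjacent sectors become the upper and lower half-planes.

Decay: `energy` is nondecreasing along steep enough upward paths and vanishes at zeros of `g`. From
a large zero away from the negative axis one can climb to the positive imaginary axis, above which
`‖g‖` is then nondecreasing. Decay there would force `g = 0` on a ray, so large zeros do not exist
(`NormalForm.zero_free_of_tendsto`). Conjugation handles the other half-plane.

Growth: on a disc of fixed size `g` is close to `A cos + B sin`, which has a nearby zero unless `A ^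
2 + B ^ 2` is relatively small. In a zero-free sector `g' / g` is therefore near `I` or `-I`, with
the same sign throughout by connectedness. So `g` resembles `exp (I w)` or `exp (-I w)` and cannot
grow on both bounding rays (`NormalForm.exists_zero_of_tendsto`). -/

/-! ### Energy monotonicity and zero-free regions from decay -/

/-- `g'` is the derivative of `g` on the slit plane, `g'' = -Q g` there, and `Q → 1` at infinity. -/
structure NormalForm (g g' Q : ℂ → ℂ) : Prop where
  hasDerivAt : ∀ w ∈ slitPlane, HasDerivAt g (g' w) w
  hasDerivAt_deriv : ∀ w ∈ slitPlane, HasDerivAt g' (-(Q w * g w)) w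
  asymptotic : ∀ κ : ℝ, 0 < κ → ∃ R : ℝ, 0 < R ∧ ∀ w ∈ slitPlane, R ≤ ‖w‖ → ‖Q w - 1‖ ≤ κ

/-- The quadratic form `Re (i g' conj g)`, monotone along upward paths. -/
def energy (g g' : ℂ → ℂ) (w : ℂ) : ℝ := -(g' w * conj (g w)).im

/-- Exchanges the half-planes, so that decay on the negative imaginary axis reduces to decay on the
positive one. -/
lemma NormalForm.conj (h : NormalForm g g' Q) :
    NormalForm (conj ∘ g ∘ conj) (conj ∘ g' ∘ conj) (conj ∘ Q ∘ conj) where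
  hasDerivAt w hw := by
    have := (h.hasDerivAt (conj w) (by simpa [mem_slitPlane_iff] using hw)).conj_conj
    simpa using this
  hasDerivAt_deriv w hw := by
    have := (h.hasDerivAt_deriv (conj w) (by simpa [mem_slitPlane_iff] using hw)).conj_conj
    simpa using this
  asymptotic κ hκ := by
    obtain ⟨R, hR, H⟩ := h.asymptotic κ hκ
    refine ⟨R, hR, fun w hw hwR => ?_⟩
    have := H (conj w) (by simpa [mem_slitPlane_iff] using hw) (by simpa using hwR)
    rw [← Complex.norm_conj] at this
    simpa using this

lemma hasDerivAt_line (a d : ℂ) (t : ℝ) : HasDerivAt (fun t : ℝ => a + t * d) d t := by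
  simpa using ((hasDerivAt_id (t : ℂ)).comp_ofReal.mul_const d).const_add a

lemma NormalForm.hasDerivAt_comp_line (h : NormalForm g g' Q) {a d : ℂ} {t : ℝ}
    (ht : a + t * d ∈ slitPlane) :
    HasDerivAt (fun t : ℝ => g (a + t * d)) (g' (a + t * d) * d) t :=
  (h.hasDerivAt _ ht).comp t (hasDerivAt_line a d t)

lemma NormalForm.hasDerivAt_deriv_comp_line (h : NormalForm g g' Q) {a d : ℂ} {t : ℝ}
    (ht : a + t * d ∈ slitPlane) :
    HasDerivAt (fun t : ℝ => g' (a + t * d)) (-(Q (a + t * d) * g (a + t * d)) * d) t :=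
  (h.hasDerivAt_deriv _ ht).comp t (hasDerivAt_line a d t)

lemma NormalForm.hasDerivAt_energy (h : NormalForm g g' Q) {a d : ℂ} {t : ℝ}
    (ht : a + t * d ∈ slitPlane) :
    HasDerivAt (fun t : ℝ => energy g g' (a + t * d))
      (‖g (a + t * d)‖ ^ 2 * (Q (a + t * d) * d).im + ‖g' (a + t * d)‖ ^ 2 * d.im) t := by
  have h1 := (h.hasDerivAt_deriv_comp_line ht).mul (h.hasDerivAt_comp_line ht).star
  have h2 := (Complex.imCLM.hasFDerivAt.comp_hasDerivAt t h1).neg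
  refine (h2.congr_deriv ?_)
  rw [← Complex.normSq_eq_norm_sq, ← Complex.normSq_eq_norm_sq]
  simp [Complex.normSq_apply, Complex.mul_im, Complex.mul_re]
  ring

lemma NormalForm.hasDerivAt_norm_sq (h : NormalForm g g' Q) {a d : ℂ} {t : ℝ}
    (ht : a + t * d ∈ slitPlane) :
    HasDerivAt (fun t : ℝ => ‖g (a + t * d)‖ ^ 2)
      (2 * (g' (a + t * d) * d * conj (g (a + t * d))).re) t := by
  have h0 := h.hasDerivAt_comp_line ht
  have h1 := h0.mul h0.star
  have h2 := (Complex.reCLM.hasFDerivAt.comp_hasDerivAt t h1)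
  refine (h2.congr_deriv ?_).congr_of_eventuallyEq (Eventually.of_forall fun s => ?_)
  · simp [Complex.mul_im, Complex.mul_re]
    ring
  · simp [← Complex.normSq_eq_norm_sq, Complex.normSq_apply]

/-- The slope condition on `d` absorbs the deviation of `q` from `1`; this is what "steep enough"
means for a path. -/
lemma im_mul_nonneg {q d : ℂ} {κ : ℝ} (hq : ‖q - 1‖ ≤ κ) (hd : κ * ‖d‖ ≤ d.im) :
    0 ≤ (q * d).im := by
  have h1 : (q * d).im = d.im + ((q - 1) * d).im := by
    simp [Complex.mul_im]; ring
  have h2 := (abs_le.1 (Complex.abs_im_le_norm ((q - 1) * d))).1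
  rw [norm_mul] at h2
  have h3 := mul_le_mul_of_nonneg_right hq (norm_nonneg d)
  linarith

lemma NormalForm.energy_monotoneOn (h : NormalForm g g' Q) {a d : ℂ} {κ : ℝ} {s : Set ℝ}
    (hs : Convex ℝ s) (hκ : 0 ≤ κ) (hslit : ∀ t ∈ s, a + t * d ∈ slitPlane)
    (hQ : ∀ t ∈ s, ‖Q (a + t * d) - 1‖ ≤ κ) (hd : κ * ‖d‖ ≤ d.im) :
    MonotoneOn (fun t : ℝ => energy g g' (a + t * d)) s := by
  have hD := fun t ht => h.hasDerivAt_energy (hslit t ht)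
  refine monotoneOn_of_deriv_nonneg hs
    (fun t ht => (hD t ht).continuousAt.continuousWithinAt)
    (fun t ht => (hD t (interior_subset ht)).differentiableAt.differentiableWithinAt)
    fun t ht => ?_
  rw [(hD t (interior_subset ht)).deriv]
  have h1 := im_mul_nonneg (hQ t (interior_subset ht)) hd
  have h2 : 0 ≤ d.im := le_trans (by positivity) hd
  positivity

lemma NormalForm.energy_le (h : NormalForm g g' Q) {a b : ℂ} {κ : ℝ} (hκ : 0 ≤ κ)
    (hslit : ∀ t ∈ Set.Icc (0 : ℝ) 1, a + t * (b - a) ∈ slitPlane)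
    (hQ : ∀ t ∈ Set.Icc (0 : ℝ) 1, ‖Q (a + t * (b - a)) - 1‖ ≤ κ)
    (hd : κ * ‖b - a‖ ≤ (b - a).im) : energy g g' a ≤ energy g g' b := by
  have := h.energy_monotoneOn (convex_Icc 0 1) hκ hslit hQ hd (by simp : (0 : ℝ) ∈ Set.Icc (0 : ℝ) 1)
    (by simp : (1 : ℝ) ∈ Set.Icc (0 : ℝ) 1) zero_le_one
  simpa using this

/-- If the energy is nonnegative somewhere high on the positive imaginary axis and `g → 0` along
it, then `g` vanishes on a ray. -/
lemma NormalForm.eq_zero_of_energy_nonneg (h : NormalForm g g' Q) {R y : ℝ} (hR : 0 < R)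
    (hy : R ≤ y) (hQ : ∀ w ∈ slitPlane, R ≤ ‖w‖ → ‖Q w - 1‖ ≤ 1)
    (hE : 0 ≤ energy g g' (y * I))
    (hlim : Tendsto (fun t : ℝ => g (t * I)) atTop (𝓝 0)) (t : ℝ) (ht : y ≤ t) :
    g (t * I) = 0 := by
  have hslit : ∀ t ∈ Set.Ici y, (0 : ℂ) + t * I ∈ slitPlane := by
    intro t ht
    have : (0 : ℝ) < t := hR.trans_le (hy.trans ht)
    simp [mem_slitPlane_iff, this.ne']
  have hmono := h.energy_monotoneOn (a := 0) (d := I) (convex_Ici y) zero_le_one hslit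
    (fun t ht => hQ _ (hslit t ht) (by
      have h1 : y ≤ t := ht
      have : (0 : ℝ) < t := hR.trans_le (hy.trans h1)
      simp [abs_of_pos this]; linarith)) (by simp)
  have hEn : ∀ t ∈ Set.Ici y, 0 ≤ energy g g' (t * I) := by
    intro t ht
    have := hmono (Set.mem_Ici.2 le_rfl) ht ht
    simp only [zero_add] at this
    linarith
  have hD := fun t ht => h.hasDerivAt_norm_sq (hslit t ht)
  have hm : MonotoneOn (fun t : ℝ => ‖g (0 + t * I)‖ ^ 2) (Set.Ici y) := by
    refine monotoneOn_of_deriv_nonneg (convex_Ici y)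
      (fun t ht => (hD t ht).continuousAt.continuousWithinAt)
      (fun t ht => (hD t (interior_subset ht)).differentiableAt.differentiableWithinAt)
      fun t ht => ?_
    rw [(hD t (interior_subset ht)).deriv]
    have h1 := hEn t (interior_subset ht)
    rw [energy] at h1
    -- On a vertical line the derivative of `‖g‖ ^ 2` is exactly twice the energy.
    have : (g' (0 + t * I) * I * (starRingEnd ℂ) (g (0 + t * I))).re
        = -(g' (t * I) * (starRingEnd ℂ) (g (t * I))).im := by
      rw [zero_add]; simp [Complex.mul_re, Complex.mul_im]
    rw [this]; linarith
  simp only [zero_add] at hm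
  have hle : ‖g (t * I)‖ ^ 2 ≤ 0 := by
    have hl : Tendsto (fun t : ℝ => ‖g (t * I)‖ ^ 2) atTop (𝓝 0) := by
      simpa using hlim.norm.pow 2
    refine ge_of_tendsto hl ?_
    filter_upwards [eventually_ge_atTop t] with s hs
    exact hm ht (ht.trans hs) hs
  have : ‖g (t * I)‖ = 0 := by nlinarith [norm_nonneg (g (t * I))]
  simpa using this

/-- Energy comparison from a point of the upper half-plane to the imaginary axis. -/
lemma NormalForm.energy_le_imaginary_axis (h : NormalForm g g' Q) {R : ℝ} (hR : 0 < R)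
    (hQ : ∀ w ∈ slitPlane, R ≤ ‖w‖ → ‖Q w - 1‖ ≤ 1 / 2) {w : ℂ} (hw : w ∈ slitPlane)
    (him : 0 ≤ w.im) (hwR : 2 * R ≤ ‖w‖) :
    energy g g' w ≤ energy g g' ((w.im + |w.re| : ℝ) * I) := by
  have hn := Complex.sq_norm w
  rw [normSq_apply] at hn
  have key : ∀ t ∈ Set.Icc (0 : ℝ) 1, w + t * ((w.im + |w.re| : ℝ) * I - w) ∈ slitPlane ∧
      R ≤ ‖w + t * ((w.im + |w.re| : ℝ) * I - w)‖ := by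
    rintro t ⟨h0, h1⟩
    set v := w + t * ((w.im + |w.re| : ℝ) * I - w) with hv
    have hre : v.re = (1 - t) * w.re := by simp [hv]; ring
    have hi : v.im = w.im + t * |w.re| := by simp [hv]
    have hnv := Complex.sq_norm v
    rw [normSq_apply, hre, hi] at hnv
    have hb : R ^ 2 ≤ ‖v‖ ^ 2 := by
      rw [hnv]
      have : (2 * R) ^ 2 ≤ ‖w‖ ^ 2 := by gcongr
      have h3 : 0 ≤ w.im * (t * |w.re|) := by positivity
      -- The segment has slope ±1, and `(1 - t) ^ 2 + t ^ 2 ≥ 1 / 2` gives `‖v‖ ^ 2 ≥ ‖w‖ ^ 2 / 2`.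
      nlinarith [sq_abs w.re, sq_nonneg ((2 * t - 1) * w.re), sq_nonneg w.im]
    have hRv : R ≤ ‖v‖ := by
      exact le_of_sq_le_sq hb (norm_nonneg _)
    refine ⟨?_, hRv⟩
    rw [mem_slitPlane_iff]
    rcases h0.eq_or_lt with rfl | h0
    · rw [hre, hi]; rw [mem_slitPlane_iff] at hw; simpa using hw
    by_cases hx : w.re = 0
    · right
      rw [hi, hx]
      have : v.re = 0 := by rw [hre, hx]; simp
      intro h4
      have : v = 0 := Complex.ext this (by rw [hi, hx]; simpa using h4)
      rw [this] at hRv; simp at hRv; linarith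
    · right; rw [hi]; positivity
  refine h.energy_le (κ := 1 / 2) (by norm_num) (fun t ht => (key t ht).1)
    (fun t ht => hQ _ (key t ht).1 (key t ht).2) ?_
  have h1 := Complex.norm_le_abs_re_add_abs_im ((w.im + |w.re| : ℝ) * I - w)
  have h2 : ((w.im + |w.re| : ℝ) * I - w).re = - w.re := by simp
  have h3 : ((w.im + |w.re| : ℝ) * I - w).im = |w.re| := by simp
  rw [h2, h3, abs_neg, abs_abs] at h1
  rw [h3]; linarith

/-- Energy comparison from a point of the lower half-plane to the positive real axis. -/
lemma NormalForm.energy_le_real_axis (h : NormalForm g g' Q) {R s : ℝ} (hs : 0 < s)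
    (hs1 : s ≤ 1)
    (hQ : ∀ w ∈ slitPlane, R ≤ ‖w‖ → ‖Q w - 1‖ ≤ s / 2) {w : ℂ}
    (him : w.im < 0) (hre : -(1 - s) * ‖w‖ ≤ w.re) (hwR : R ≤ ‖w‖ * (s / 2)) :
    energy g g' w ≤ energy g g' (‖w‖ : ℝ) := by
  have hn := Complex.sq_norm w
  rw [normSq_apply] at hn
  have hw0 : 0 < ‖w‖ := by
    rw [norm_pos_iff]; rintro rfl; simp at him
  have key : ∀ t ∈ Set.Icc (0 : ℝ) 1, w + t * ((‖w‖ : ℝ) - w) ∈ slitPlane ∧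
      R ≤ ‖w + t * ((‖w‖ : ℝ) - w)‖ := by
    rintro t ⟨h0, h1⟩
    set v := w + t * ((‖w‖ : ℝ) - w) with hv
    have hvre : v.re = (1 - t) * w.re + t * ‖w‖ := by simp [hv]; ring
    have hvi : v.im = (1 - t) * w.im := by simp [hv]; ring
    have hnv := Complex.sq_norm v
    rw [normSq_apply, hvre, hvi] at hnv
    have hb : (‖w‖ * (s / 2)) ^ 2 ≤ ‖v‖ ^ 2 := by
      rw [hnv]
      have e : ((1 - t) * w.re + t * ‖w‖) * ((1 - t) * w.re + t * ‖w‖) +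
        (1 - t) * w.im * ((1 - t) * w.im) = ((1 - t) ^ 2 + t ^ 2) * ‖w‖ ^ 2
          + 2 * (t * (1 - t)) * ‖w‖ * w.re := by
        linear_combination -(1 - t) ^ 2 * hn
      rw [e]
      have h2 : 0 ≤ t * (1 - t) := mul_nonneg h0 (by linarith)
      have h3 : 2 * (t * (1 - t)) * ‖w‖ * (-(1 - s) * ‖w‖) ≤ 2 * (t * (1 - t)) * ‖w‖ * w.re :=
        mul_le_mul_of_nonneg_left hre (by positivity)
      -- The right side is smallest at the midpoint `t = 1 / 2` of the chord, where it equals `s /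
      -- 2`.
      have h4 : s / 2 ≤ (1 - t) ^ 2 + t ^ 2 - 2 * (t * (1 - t)) * (1 - s) := by
        nlinarith [sq_nonneg (2 * t - 1), mul_nonneg (sub_nonneg.2 hs1) (sq_nonneg (2 * t - 1))]
      have h5 : (s / 2) ^ 2 ≤ s / 2 := by nlinarith
      nlinarith [mul_le_mul_of_nonneg_right (h5.trans h4) (sq_nonneg ‖w‖)]
    have hRv : R ≤ ‖v‖ := hwR.trans (le_of_sq_le_sq hb (norm_nonneg _))
    refine ⟨?_, hRv⟩
    rw [mem_slitPlane_iff, hvre, hvi]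
    rcases h1.eq_or_lt with rfl | h1
    · left; simpa using hw0
    · right; exact mul_ne_zero (by linarith) him.ne
  refine h.energy_le (κ := s / 2) (by positivity) (fun t ht => (key t ht).1)
    (fun t ht => hQ _ (key t ht).1 (key t ht).2) ?_
  have h1 := Complex.sq_norm ((‖w‖ : ℝ) - w)
  rw [normSq_apply] at h1
  have h2 : (((‖w‖ : ℝ) : ℂ) - w).re = ‖w‖ - w.re := by simp
  have h3 : (((‖w‖ : ℝ) : ℂ) - w).im = -w.im := by simp
  rw [h2, h3] at h1
  rw [h3]
  refine le_of_sq_le_sq ?_ (by linarith)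
  rw [mul_pow, h1]
  have h6 : w.re ≤ ‖w‖ := Complex.re_le_norm w
  have e1 : (‖w‖ - w.re) * (‖w‖ - w.re) + -w.im * -w.im = 2 * ‖w‖ * (‖w‖ - w.re) := by
    nlinarith
  have e2 : (-w.im) ^ 2 = (‖w‖ - w.re) * (‖w‖ + w.re) := by nlinarith
  rw [e1, e2]
  -- Staying away from the negative axis keeps the chord from being too flat: its slope is
  -- controlled by `‖w‖ + w.re ≥ s * ‖w‖`.
  have h7 : s * ‖w‖ ≤ ‖w‖ + w.re := by nlinarith
  have h8 := mul_le_mul_of_nonneg_left h7 (sub_nonneg.2 h6)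
  have h9 : 0 ≤ (‖w‖ - w.re) * ‖w‖ := mul_nonneg (sub_nonneg.2 h6) hw0.le
  nlinarith [mul_nonneg hs.le h9]

/-- A solution decaying along the positive imaginary axis has no large zeros away from the negative
real axis, unless it vanishes on a ray. -/
theorem NormalForm.zero_free_of_tendsto (h : NormalForm g g' Q) {s : ℝ} (hs : 0 < s) (hs1 : s ≤ 1)
    (hlim : Tendsto (fun t : ℝ => g (t * I)) atTop (𝓝 0))
    (hne : ∃ᶠ t : ℝ in atTop, g (t * I) ≠ 0) :
    ∃ R : ℝ, ∀ w ∈ slitPlane, R ≤ ‖w‖ → -(1 - s) * ‖w‖ ≤ w.re → g w ≠ 0 := by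
  obtain ⟨R, hR, hQ⟩ := h.asymptotic (s / 2) (by positivity)
  have hQ2 : ∀ w ∈ slitPlane, R ≤ ‖w‖ → ‖Q w - 1‖ ≤ 1 / 2 :=
    fun w hw hwR => (hQ w hw hwR).trans (by linarith)
  have hQ1 : ∀ w ∈ slitPlane, R ≤ ‖w‖ → ‖Q w - 1‖ ≤ 1 :=
    fun w hw hwR => (hQ w hw hwR).trans (by linarith)
  have fin : ∀ y, R ≤ y → ¬ 0 ≤ energy g g' ((y : ℝ) * I) := fun y hy hE => hne <| by
    filter_upwards [eventually_ge_atTop y] with t ht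
    simpa using h.eq_zero_of_energy_nonneg hR hy hQ1 hE hlim t ht
  have up : ∀ w ∈ slitPlane, 0 ≤ w.im → 2 * R ≤ ‖w‖ → ¬ 0 ≤ energy g g' w := by
    intro w hw him hwR hE
    refine fin _ ?_ (hE.trans (h.energy_le_imaginary_axis hR hQ2 hw him hwR))
    have := Complex.norm_le_abs_re_add_abs_im w
    rw [abs_of_nonneg him] at this
    linarith
  refine ⟨2 * R / s, fun w hw hwR hre h0 => ?_⟩
  have hE : energy g g' w = 0 := by simp [energy, h0]
  rw [div_le_iff₀ hs] at hwR
  have hwR2 : 2 * R ≤ ‖w‖ := hwR.trans (mul_le_of_le_one_right (norm_nonneg _) hs1)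
  rcases le_or_gt 0 w.im with him | him
  · exact up w hw him hwR2 hE.ge
  · refine up (‖w‖ : ℝ) ?_ (by simp) (by simpa using hwR2)
      (hE.ge.trans (h.energy_le_real_axis hs hs1 hQ him hre (by linarith)))
    simp [mem_slitPlane_iff]; rintro rfl; simp at him

/-! ### Trigonometric comparison on discs of fixed size -/

/-- Comparison of a solution of `g'' = -Q g`, `Q` close to `1`, with a trigonometric function. -/
lemma norm_sub_trig_le {w₀ : ℂ} {L κ M : ℝ} (hL : 0 < L) (hκ : 0 ≤ κ) (hκ1 : κ ≤ 1)
    (hg : ∀ w, ‖w - w₀‖ ≤ L → HasDerivAt g (g' w) w)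
    (hg' : ∀ w, ‖w - w₀‖ ≤ L → HasDerivAt g' (-(Q w * g w)) w)
    (hQ : ∀ w, ‖w - w₀‖ ≤ L → ‖Q w - 1‖ ≤ κ)
    (hM : ‖g w₀‖ ≤ M) (hM' : ‖g' w₀‖ ≤ M) {u : ℂ} (hu : ‖u‖ ≤ L) :
    ‖g (w₀ + u) - (g w₀ * cos u + g' w₀ * sin u)‖ ≤
      κ * M * (Real.exp (2 * L) * (Real.exp L - 1)) := by
  have hM0 : 0 ≤ M := (norm_nonneg _).trans hM
  have hin : ∀ t ∈ Set.Icc (0 : ℝ) 1, ‖w₀ + t * u - w₀‖ ≤ L := by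
    rintro t ⟨h0, h1⟩
    rw [add_sub_cancel_left, norm_mul, Complex.norm_real, Real.norm_of_nonneg h0]
    nlinarith [norm_nonneg u]
  have d1 : ∀ t ∈ Set.Icc (0 : ℝ) 1, HasDerivAt (fun t : ℝ => g (w₀ + t * u))
      (g' (w₀ + t * u) * u) t := fun t ht => (hg _ (hin t ht)).comp t (hasDerivAt_line w₀ u t)
  have d2 : ∀ t ∈ Set.Icc (0 : ℝ) 1, HasDerivAt (fun t : ℝ => g' (w₀ + t * u))
      (-(Q (w₀ + t * u) * g (w₀ + t * u)) * u) t :=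
    fun t ht => (hg' _ (hin t ht)).comp t (hasDerivAt_line w₀ u t)
  have hQn : ∀ t ∈ Set.Icc (0 : ℝ) 1, ‖Q (w₀ + t * u)‖ ≤ 2 := by
    intro t ht
    have := norm_le_norm_add_norm_sub' (Q (w₀ + t * u)) 1
    have h2 := hQ _ (hin t ht)
    rw [norm_one] at this
    linarith
  -- Gronwall for the pair `(g, g')` in the sup norm; the rate `2 * L` comes from `‖Q‖ ≤ 2` and `‖u‖
  -- ≤ L`.
  have bound : ∀ t ∈ Set.Icc (0 : ℝ) 1, ‖g (w₀ + t * u)‖ ≤ M * Real.exp (2 * L) := by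
    intro t ht
    have := norm_le_gronwallBound_of_norm_deriv_right_le
      (f := fun t : ℝ => (g (w₀ + t * u), g' (w₀ + t * u)))
      (f' := fun t : ℝ => (g' (w₀ + t * u) * u, -(Q (w₀ + t * u) * g (w₀ + t * u)) * u))
      (δ := M) (K := 2 * L) (ε := 0) (a := 0) (b := 1)
      (fun t ht => ((d1 t ht).prodMk (d2 t ht)).continuousAt.continuousWithinAt)
      (fun t ht => ((d1 t (Set.Ico_subset_Icc_self ht)).prodMk
        (d2 t (Set.Ico_subset_Icc_self ht))).hasDerivWithinAt)
      (by simpa using ⟨hM, hM'⟩)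
      (fun t ht => by
        have hb := hQn t (Set.Ico_subset_Icc_self ht)
        rw [Prod.norm_mk, Prod.norm_mk, add_zero, norm_mul, norm_mul, norm_neg, norm_mul]
        refine max_le ?_ ?_
        · calc ‖g' (w₀ + t * u)‖ * ‖u‖ ≤ max ‖g (w₀ + t * u)‖ ‖g' (w₀ + t * u)‖ * (2 * L) := by
                gcongr
                · exact le_max_right _ _
                · linarith
            _ = _ := mul_comm _ _
        · calc ‖Q (w₀ + t * u)‖ * ‖g (w₀ + t * u)‖ * ‖u‖
              ≤ 2 * max ‖g (w₀ + t * u)‖ ‖g' (w₀ + t * u)‖ * L := by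
                gcongr
                exact le_max_left _ _
            _ = _ := by ring)
      t ht
    rw [gronwallBound_ε0, sub_zero] at this
    refine (le_trans (le_max_left _ _) this).trans ?_
    have hLt : 2 * L * t ≤ 2 * L := mul_le_of_le_one_right (by positivity) ht.2
    gcongr
  have c1 : ∀ t : ℝ, HasDerivAt (fun t : ℝ => g w₀ * cos (t * u) + g' w₀ * sin (t * u))
      ((-(g w₀ * sin (t * u)) + g' w₀ * cos (t * u)) * u) t := by
    intro t
    have hl := hasDerivAt_line 0 u t
    simp only [zero_add] at hl
    refine ((((Complex.hasDerivAt_cos _).comp t hl).const_mul (g w₀)).add (((Complex.hasDerivAt_sin _).comp t hl).const_mul (g' w₀))).congr_deriv ?_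
    ring
  have c2 : ∀ t : ℝ, HasDerivAt (fun t : ℝ => -(g w₀ * sin (t * u)) + g' w₀ * cos (t * u))
      (-(g w₀ * cos (t * u) + g' w₀ * sin (t * u)) * u) t := by
    intro t
    have hl := hasDerivAt_line 0 u t
    simp only [zero_add] at hl
    refine ((((Complex.hasDerivAt_sin _).comp t hl).const_mul (g w₀)).neg.add (((Complex.hasDerivAt_cos _).comp t hl).const_mul (g' w₀))).congr_deriv ?_
    ring
  -- Second Gronwall, for the difference: the constant-coefficient system has rate `L`, and `(Q - 1)
  -- * g` is the forcing term.
  have key := norm_le_gronwallBound_of_norm_deriv_right_le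
      (f := fun t : ℝ => (g (w₀ + t * u) - (g w₀ * cos (t * u) + g' w₀ * sin (t * u)),
        g' (w₀ + t * u) - (-(g w₀ * sin (t * u)) + g' w₀ * cos (t * u))))
      (f' := fun t : ℝ =>
        (g' (w₀ + t * u) * u - ((-(g w₀ * sin (t * u)) + g' w₀ * cos (t * u)) * u),
        -(Q (w₀ + t * u) * g (w₀ + t * u)) * u
          - (-(g w₀ * cos (t * u) + g' w₀ * sin (t * u)) * u)))
      (δ := 0) (K := L) (ε := L * (κ * (M * Real.exp (2 * L)))) (a := 0) (b := 1)
      (fun t ht => (((d1 t ht).sub (c1 t)).prodMk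
        ((d2 t ht).sub (c2 t))).continuousAt.continuousWithinAt)
      (fun t ht => (((d1 t (Set.Ico_subset_Icc_self ht)).sub (c1 t)).prodMk
        ((d2 t (Set.Ico_subset_Icc_self ht)).sub (c2 t))).hasDerivWithinAt)
      (by simp)
      (fun t ht => by
        have hb := bound t (Set.Ico_subset_Icc_self ht)
        have hq := hQ _ (hin t (Set.Ico_subset_Icc_self ht))
        rw [Prod.norm_mk, Prod.norm_mk]
        set y1 := g (w₀ + t * u) - (g w₀ * cos (t * u) + g' w₀ * sin (t * u)) with hy1
        set y2 := g' (w₀ + t * u) - (-(g w₀ * sin (t * u)) + g' w₀ * cos (t * u)) with hy2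
        have e1 : g' (w₀ + t * u) * u - ((-(g w₀ * sin (t * u)) + g' w₀ * cos (t * u)) * u)
            = u * y2 := by rw [hy2]; ring
        have e2 : -(Q (w₀ + t * u) * g (w₀ + t * u)) * u
          - (-(g w₀ * cos (t * u) + g' w₀ * sin (t * u)) * u)
            = -(u * (y1 + (Q (w₀ + t * u) - 1) * g (w₀ + t * u))) := by rw [hy1]; ring
        rw [e1, e2, norm_neg, norm_mul, norm_mul]
        refine max_le ?_ ?_
        · have : ‖u‖ * ‖y2‖ ≤ L * max ‖y1‖ ‖y2‖ := by
            gcongr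
            exact le_max_right _ _
          have h2 : 0 ≤ L * (κ * (M * Real.exp (2 * L))) := by positivity
          linarith
        · rw [← mul_add]
          gcongr
          refine (norm_add_le _ _).trans ?_
          rw [norm_mul]
          gcongr
          exact le_max_left _ _)
      1 (by simp)
  rw [gronwallBound_of_K_ne_0 hL.ne', Prod.norm_mk] at key
  have := (le_max_left _ _).trans key
  simp only [ofReal_one, one_mul, sub_zero, mul_one, zero_mul, zero_add] at this
  rw [mul_div_cancel_left₀ _ hL.ne'] at this
  linarith

/-- A nondegenerate trigonometric combination equals a translated sine, with centre bounded in
terms of the degeneracy. -/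
lemma exists_trig_eq_sin {A B : ℂ} {δ : ℝ} (hδ : 0 < δ) (hn : ‖A‖ ^ 2 + ‖B‖ ^ 2 = 1)
    (h : δ ≤ ‖A ^ 2 + B ^ 2‖) :
    ∃ u c : ℂ, ‖u‖ ≤ Real.log (2 / δ) + Real.pi ∧ ‖c‖ ^ 2 = ‖A ^ 2 + B ^ 2‖ ∧
      ∀ v, A * cos (u + v) + B * sin (u + v) = c * sin v := by
  -- `A cos z + B sin z = (b exp (I z) - a exp (-I z)) / (2 I)`, which vanishes when `exp (2 I z) =
  -- a / b`; hence the choice of `u` below.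
  set a := B - I * A with ha
  set b := B + I * A with hb
  have hab : a * b = A ^ 2 + B ^ 2 := by
    rw [ha, hb]; linear_combination -A ^ 2 * I_sq
  have hab0 : 0 < ‖a‖ * ‖b‖ := by rw [← norm_mul, hab]; linarith
  have ha0 : 0 < ‖a‖ := by
    rcases (norm_nonneg a).eq_or_lt with h | h
    · rw [← h, zero_mul] at hab0; exact absurd hab0 (lt_irrefl _)
    · exact h
  have hb0 : 0 < ‖b‖ := pos_of_mul_pos_right hab0 ha0.le
  have hA1 : ‖A‖ ≤ 1 := by nlinarith [norm_nonneg A, sq_nonneg ‖B‖]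
  have hB1 : ‖B‖ ≤ 1 := by nlinarith [norm_nonneg B, sq_nonneg ‖A‖]
  have ha2 : ‖a‖ ≤ 2 := (norm_sub_le _ _).trans (by rw [norm_mul, norm_I]; linarith)
  have hb2 : ‖b‖ ≤ 2 := (norm_add_le _ _).trans (by rw [norm_mul, norm_I]; linarith)
  have hnab : δ ≤ ‖a‖ * ‖b‖ := by rw [← norm_mul, hab]; exact h
  have hane : a ≠ 0 := norm_pos_iff.1 ha0
  have hbne : b ≠ 0 := norm_pos_iff.1 hb0
  set u := log (a / b) / (2 * I) with hu
  have hexp : exp (u * I) ^ 2 * b = a := by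
    rw [← Complex.exp_nat_mul]
    have : ((2 : ℕ) : ℂ) * (u * I) = log (a / b) := by
      rw [hu]; push_cast; field_simp
    rw [this, Complex.exp_log (div_ne_zero hane hbne)]
    field_simp
  have hexp' : exp (u * I) * exp (-u * I) = 1 := by
    rw [← Complex.exp_add]; simp
  refine ⟨u, b * exp (u * I), ?_, ?_, fun v => ?_⟩
  · have h1 : ‖u‖ = ‖log (a / b)‖ / 2 := by rw [hu]; simp
    have h2 := Complex.norm_le_abs_re_add_abs_im (log (a / b))
    rw [Complex.log_re, Complex.log_im] at h2
    have h3 := Complex.abs_arg_le_pi (a / b)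
    -- Both factors have modulus at most `2` and their product at least `δ`, so neither is small.
    have h4 : |Real.log ‖a / b‖| ≤ 2 * Real.log (2 / δ) := by
      have hδ2 : Real.log (2 / δ) = Real.log 2 - Real.log δ := Real.log_div two_ne_zero hδ.ne'
      have l1 : Real.log δ ≤ Real.log ‖a‖ + Real.log ‖b‖ := by
        rw [← Real.log_mul ha0.ne' hb0.ne']; exact Real.log_le_log hδ hnab
      have l2 := Real.log_le_log ha0 ha2
      have l3 := Real.log_le_log hb0 hb2
      have l4 : Real.log δ ≤ 0 := by
        refine Real.log_nonpos hδ.le (h.trans ((norm_add_le _ _).trans ?_))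
        rw [norm_pow, norm_pow, hn]
      rw [norm_div, Real.log_div ha0.ne' hb0.ne', hδ2, abs_le]
      constructor <;> linarith
    rw [h1]
    have : 0 ≤ Real.pi := Real.pi_pos.le
    linarith
  · rw [← hab, ← hexp]
    simp only [norm_mul, norm_pow]; ring
  · have p1 : exp ((u + v) * I) = exp (u * I) * exp (v * I) := by
      rw [add_mul, Complex.exp_add]
    have p2 : exp (-(u + v) * I) = exp (-u * I) * exp (-v * I) := by
      rw [← Complex.exp_add]; congr 1; ring
    rw [Complex.cos, Complex.sin, Complex.sin, p1, p2]
    set E := exp (u * I)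
    set F := exp (-u * I)
    have hA : A = -(b - a) * I / 2 := by rw [ha, hb]; linear_combination A * I_sq
    have hB : B = (b + a) / 2 := by rw [ha, hb]; ring
    have haF : a * F = b * E := by
      rw [← hexp]; linear_combination b * E * hexp'
    rw [hA, hB]
    linear_combination I / 2 * exp (-v * I) * haF

lemma half_le_norm_sin {v : ℂ} (hv : ‖v‖ = 1) : 1 / 2 ≤ ‖sin v‖ := by
  have h := Complex.sin_bound hv.le
  have h1 : ‖v - v ^ 3 / 6‖ ≥ 1 - 1 / 6 := by
    have := norm_sub_norm_le v (v ^ 3 / 6)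
    rw [norm_div, norm_pow, hv] at this
    simpa using this
  have h2 := norm_sub_norm_le (v - v ^ 3 / 6) (v - v ^ 3 / 6 - sin v)
  rw [sub_sub_cancel, norm_sub_rev (v - v ^ 3 / 6) (sin v)] at h2
  rw [hv] at h
  norm_num at h h1
  linarith

/-- On a large zero-free disc, a solution of `g'' = -Q g` with `Q` close to `1` is nearly a pure
exponential `exp (± i w)` at the centre. -/
lemma exists_radius_near_exponential {δ : ℝ} (hδ : 0 < δ) (hδ1 : δ ≤ 1) :
    ∃ L κ : ℝ, 0 < L ∧ 0 < κ ∧ ∀ (g g' Q : ℂ → ℂ) (w₀ : ℂ),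
      (∀ w, ‖w - w₀‖ ≤ L → HasDerivAt g (g' w) w) →
      (∀ w, ‖w - w₀‖ ≤ L → HasDerivAt g' (-(Q w * g w)) w) →
      (∀ w, ‖w - w₀‖ ≤ L → ‖Q w - 1‖ ≤ κ) → (∀ w, ‖w - w₀‖ ≤ L → g w ≠ 0) →
      ‖g w₀ ^ 2 + g' w₀ ^ 2‖ ≤ δ * (‖g w₀‖ ^ 2 + ‖g' w₀‖ ^ 2) := by
  -- Bound on the centre `u` of `exists_trig_eq_sin`, plus `1` for a unit disc around it.
  set L := Real.log (2 / δ) + Real.pi + 1 with hLdef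
  have hlog : 0 ≤ Real.log (2 / δ) := Real.log_nonneg (by rw [le_div_iff₀ hδ]; linarith)
  have hL : 0 < L := by have := Real.pi_pos; linarith
  set C := Real.exp (2 * L) * (Real.exp L - 1) with hC
  have hC0 : 0 ≤ C := by
    have := Real.one_le_exp hL.le
    exact mul_nonneg (Real.exp_pos _).le (by linarith)
  -- This `κ` makes the comparison error at most `N * (δ / 8)`.
  refine ⟨L, δ / (8 * (C + 1)), hL, by positivity, fun g g' Q w₀ hg hg' hQ hz => ?_⟩
  by_contra! hcon
  set κ := δ / (8 * (C + 1)) with hκ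
  have hκ0 : 0 ≤ κ := by positivity
  have hκC : κ * C ≤ δ / 8 := by
    have : κ * (C + 1) = δ / 8 := by rw [hκ]; field_simp
    nlinarith
  have hκ1 : κ ≤ 1 := by
    rw [hκ, div_le_one (by positivity)]; linarith
  have hA0 : 0 < ‖g w₀‖ := norm_pos_iff.2 (hz _ (by simpa using hL.le))
  set N := Real.sqrt (‖g w₀‖ ^ 2 + ‖g' w₀‖ ^ 2) with hN
  have hN2 : N ^ 2 = ‖g w₀‖ ^ 2 + ‖g' w₀‖ ^ 2 := Real.sq_sqrt (by positivity)
  have hN0 : 0 < N := Real.sqrt_pos.2 (by positivity)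
  have hNc : (N : ℂ) ≠ 0 := by exact_mod_cast hN0.ne'
  have hgN : ‖g w₀‖ ≤ N := le_of_sq_le_sq (by nlinarith [sq_nonneg ‖g' w₀‖]) hN0.le
  have hgN' : ‖g' w₀‖ ≤ N := le_of_sq_le_sq (by nlinarith [sq_nonneg ‖g w₀‖]) hN0.le
  obtain ⟨u, c, hu, hc, hsin⟩ := exists_trig_eq_sin (A := g w₀ / N) (B := g' w₀ / N) hδ
    (by rw [norm_div, norm_div, Complex.norm_real, Real.norm_of_nonneg hN0.le, div_pow, div_pow,
          ← add_div, ← hN2, div_self (by positivity)])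
    (by rw [div_pow, div_pow, ← add_div, norm_div, norm_pow, Complex.norm_real,
          Real.norm_of_nonneg hN0.le, le_div_iff₀ (by positivity), hN2]
        exact hcon.le)
  have hcδ : δ ≤ ‖c‖ := by
    refine le_of_sq_le_sq ?_ (norm_nonneg _)
    rw [hc, div_pow, div_pow, ← add_div, norm_div, norm_pow, Complex.norm_real,
          Real.norm_of_nonneg hN0.le, le_div_iff₀ (by positivity), hN2]
    refine le_trans ?_ hcon.le
    gcongr
    nlinarith
  have hclose : ∀ v : ℂ, ‖v‖ ≤ 1 → ‖g (w₀ + (u + v)) - N * (c * sin v)‖ ≤ N * (δ / 8) := by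
    intro v hv
    have := norm_sub_trig_le hL hκ0 hκ1 hg hg' hQ hgN hgN' (u := u + v)
      ((norm_add_le _ _).trans (by linarith))
    rw [← hsin v]
    have e : (N : ℂ) * (g w₀ / N * cos (u + v) + g' w₀ / N * sin (u + v))
        = g w₀ * cos (u + v) + g' w₀ * sin (u + v) := by field_simp
    rw [e]
    refine this.trans ?_
    calc κ * N * C = N * (κ * C) := by ring
      _ ≤ _ := by gcongr
  have hball : ∀ z ∈ Metric.closedBall (w₀ + u) 1, ‖z - w₀‖ ≤ L := by
    intro z hz
    rw [Metric.mem_closedBall, dist_eq_norm] at hz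
    calc ‖z - w₀‖ = ‖(z - (w₀ + u)) + u‖ := by congr 1; ring
      _ ≤ ‖z - (w₀ + u)‖ + ‖u‖ := norm_add_le _ _
      _ ≤ L := by linarith
  have hdiff : DiffContOnCl ℂ (fun z => (g z)⁻¹) (Metric.ball (w₀ + u) 1) := by
    refine DifferentiableOn.diffContOnCl fun z hz' => ?_
    rw [closure_ball _ one_ne_zero] at hz'
    exact ((hg z (hball z hz')).differentiableAt.inv (hz z (hball z hz'))).differentiableWithinAt
  -- Maximum principle for `1 / g`: on the unit circle about `w₀ + u`, `‖g‖ ≥ N * (δ / 2) - N * (δ /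
  -- 8)`, while at its centre `‖g‖ ≤ N * (δ / 8)`. Absence of zeros is thus contradictory.
  have hmax := Complex.norm_le_of_forall_mem_frontier_norm_le Metric.isBounded_ball hdiff
    (C := (N * (δ * 3 / 8))⁻¹) (fun z hz' => by
      rw [frontier_ball _ one_ne_zero, mem_sphere_iff_norm] at hz'
      rw [norm_inv]
      refine inv_anti₀ (by positivity) ?_
      have h1 := hclose (z - (w₀ + u)) hz'.le
      have e : w₀ + (u + (z - (w₀ + u))) = z := by ring
      rw [e, norm_sub_rev] at h1
      have h2 := half_le_norm_sin hz'
      have h3 := norm_sub_norm_le ((N : ℂ) * (c * sin (z - (w₀ + u)))) (g z)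
      rw [norm_mul, norm_mul, Complex.norm_real, Real.norm_of_nonneg hN0.le] at h3
      have h4 : N * (δ * (1 / 2)) ≤ N * (‖c‖ * ‖sin (z - (w₀ + u))‖) := by gcongr
      linarith)
    (subset_closure (Metric.mem_ball_self one_pos))
  have h0 := hclose 0 (by simp)
  simp only [add_zero, sin_zero, mul_zero, sub_zero] at h0
  have hgu : 0 < ‖g (w₀ + u)‖ :=
    norm_pos_iff.2 (hz _ (hball _ (Metric.mem_closedBall_self zero_le_one)))
  rw [norm_inv, inv_le_inv₀ hgu (by positivity)] at hmax
  nlinarith [mul_pos hN0 hδ]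

/-! ### The logarithmic derivative in a zero-free sector -/

/-- A uniform neighbourhood of a truncated sector lies in a larger truncated sector. -/
lemma exists_disc_subset_sector {α β L R : ℝ} (hαβ : α < β) (hβ : β ≤ Real.pi) (hL : 0 < L) :
    ∃ S : ℝ, 0 < S ∧ ∀ s a : ℝ, S ≤ s → |a| ≤ α → ∀ w : ℂ, ‖w - s * exp (a * I)‖ ≤ L →
      w ∈ slitPlane ∧ R ≤ ‖w‖ ∧ |arg w| < β := by
  have hK : IsCompact ((fun a : ℝ => exp (a * I)) '' Set.Icc (-α) α) :=
    isCompact_Icc.image (by fun_prop)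
  have hU : IsOpen (slitPlane ∩ {v | |arg v| < β}) := by
    have hc : ContinuousOn (fun v : ℂ => |arg v|) slitPlane :=
      fun v hv => (Complex.continuousAt_arg hv).abs.continuousWithinAt
    exact hc.isOpen_inter_preimage isOpen_slitPlane isOpen_Iio
  obtain ⟨d, hd, hdU⟩ := hK.exists_cthickening_subset_open hU (by
    rintro _ ⟨a, ha, rfl⟩
    have harg : arg (exp (a * I)) = a := by
      rw [Complex.arg_exp_mul_I, toIocMod_eq_self]
      constructor <;> linarith [ha.1, ha.2]
    have habs : |a| < β := (abs_le.2 ha).trans_lt hαβ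
    refine ⟨?_, by simpa [harg] using habs⟩
    rw [Complex.mem_slitPlane_iff_arg, harg]
    exact ⟨by linarith [ha.2], Complex.exp_ne_zero _⟩)
  -- Division by `s` shrinks the disc to radius `L / s ≤ d`, inside a fixed thickening of a compact
  -- arc; the other term of the maximum keeps `‖w‖ ≥ R`.
  refine ⟨max (L / d) (|R| + L), lt_max_of_lt_left (by positivity), fun s a hs ha w hw => ?_⟩
  have hs1 : L / d ≤ s := (le_max_left _ _).trans hs
  have hs2 : |R| + L ≤ s := (le_max_right _ _).trans hs
  have hs0 : 0 < s := lt_of_lt_of_le (by positivity) hs1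
  have hsc : (s : ℂ) ≠ 0 := by exact_mod_cast hs0.ne'
  have hmem : w / s ∈ Metric.cthickening d ((fun a : ℝ => exp (a * I)) '' Set.Icc (-α) α) := by
    refine Metric.mem_cthickening_of_dist_le _ (exp (a * I)) _ _ ⟨a, abs_le.1 ha, rfl⟩ ?_
    have e : w / s - exp (a * I) = (w - s * exp (a * I)) / s := by field_simp
    rw [dist_eq_norm, e, norm_div, Complex.norm_real, Real.norm_of_nonneg hs0.le,
      div_le_iff₀ hs0]
    rw [div_le_iff₀ hd] at hs1
    linarith
  obtain ⟨h1, h2⟩ := hdU hmem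
  have e : w = s * (w / s) := by field_simp
  have harg : arg w = arg (w / s) := by
    conv_lhs => rw [e]
    exact Complex.arg_real_mul _ hs0
  have hn : ‖(s : ℂ) * exp (a * I)‖ = s := by
    rw [norm_mul, Complex.norm_exp_ofReal_mul_I, Complex.norm_real, Real.norm_of_nonneg hs0.le,
      mul_one]
  have h3 := norm_sub_norm_le ((s : ℂ) * exp (a * I)) w
  rw [norm_sub_rev, hn] at h3
  have hR : R ≤ ‖w‖ := by linarith [le_abs_self R]
  refine ⟨?_, hR, by rw [harg]; exact h2⟩
  rw [Complex.mem_slitPlane_iff_arg] at h1 ⊢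
  rw [harg]
  exact ⟨h1.1, fun h0 => h1.2 (by simp [h0])⟩

/-- For real `q` one has `‖1 + q ^ 2‖ = 1 + ‖q‖ ^ 2`, incompatible with `δ < 1`. -/
lemma im_ne_zero_of_norm_one_add_sq_le {q : ℂ} {δ : ℝ} (hδ : δ < 1)
    (h : ‖1 + q ^ 2‖ ≤ δ * (1 + ‖q‖ ^ 2)) : q.im ≠ 0 := by
  intro hq
  have e : q = (q.re : ℂ) := Complex.ext rfl (by simpa using hq)
  have e1 : 1 + q ^ 2 = ((1 + q.re ^ 2 : ℝ) : ℂ) := by rw [e]; push_cast; simp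
  have e2 : ‖q‖ ^ 2 = q.re ^ 2 := by
    rw [Complex.sq_norm, normSq_apply, hq]; ring
  rw [e1, Complex.norm_real, Real.norm_of_nonneg (by positivity), e2] at h
  nlinarith [sq_nonneg q.re]

/-- Factor `1 + q ^ 2 = (q - I) * (q + I)`; in the upper half-plane the second factor has modulus at
least `1`. -/
lemma norm_sub_I_le {q : ℂ} {δ : ℝ} (hδ0 : 0 ≤ δ) (hδ : δ ≤ 1 / 2)
    (h : ‖1 + q ^ 2‖ ≤ δ * (1 + ‖q‖ ^ 2)) (hq : 0 < q.im) : ‖q - I‖ ≤ 4 * δ := by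
  have h1 : ‖q‖ ^ 2 ≤ 1 + ‖1 + q ^ 2‖ := by
    have := norm_sub_le (1 + q ^ 2) 1
    rw [add_sub_cancel_left, norm_pow, norm_one] at this
    linarith
  have h2 : ‖1 + q ^ 2‖ ≤ 4 * δ := by nlinarith [norm_nonneg (1 + q ^ 2)]
  have e : 1 + q ^ 2 = (q - I) * (q + I) := by linear_combination I_sq
  rw [e, norm_mul] at h2
  have h3 : 1 ≤ ‖q + I‖ := by
    have := Complex.abs_im_le_norm (q + I)
    rw [Complex.add_im, I_im, abs_of_pos (by linarith)] at this
    linarith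
  nlinarith [norm_nonneg (q - I)]

/-- If the logarithmic derivative of `g` stays in a half-plane on a ray then `‖g‖` cannot tend to
infinity there. -/
lemma NormalForm.not_tendsto_norm_atTop (h : NormalForm g g' Q) {d : ℂ} {S : ℝ}
    (hslit : ∀ t : ℝ, S ≤ t → t * d ∈ slitPlane) (hz : ∀ t : ℝ, S ≤ t → g (t * d) ≠ 0)
    (hq : ∀ t : ℝ, S ≤ t → (g' (t * d) / g (t * d) * d).re ≤ 0) :
    ¬ Tendsto (fun t : ℝ => ‖g (t * d)‖) atTop atTop := by
  intro hlim
  have hslit' : ∀ t ∈ Set.Ici S, (0 : ℂ) + t * d ∈ slitPlane := fun t ht => by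
    rw [zero_add]; exact hslit t ht
  have hD := fun t ht => h.hasDerivAt_norm_sq (hslit' t ht)
  have hm : AntitoneOn (fun t : ℝ => ‖g (0 + t * d)‖ ^ 2) (Set.Ici S) := by
    refine antitoneOn_of_deriv_nonpos (convex_Ici S)
      (fun t ht => (hD t ht).continuousAt.continuousWithinAt)
      (fun t ht => (hD t (interior_subset ht)).differentiableAt.differentiableWithinAt)
      fun t ht => ?_
    have ht' : S ≤ t := interior_subset ht
    rw [(hD t ht').deriv, zero_add]
    have e : g' (t * d) * d * (starRingEnd ℂ) (g (t * d))
        = (‖g (t * d)‖ ^ 2 : ℝ) * (g' (t * d) / g (t * d) * d) := by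
      rw [← Complex.normSq_eq_norm_sq, ← Complex.mul_conj]
      have := hz t ht'
      field_simp
    rw [e, Complex.re_ofReal_mul]
    have := mul_nonpos_of_nonneg_of_nonpos (sq_nonneg ‖g (t * d)‖) (hq t ht')
    linarith
  simp only [zero_add] at hm
  obtain ⟨t, ht, hgt⟩ := ((eventually_ge_atTop S).and
    (hlim.eventually_gt_atTop ‖g (S * d)‖)).exists
  have := hm (Set.mem_Ici.2 le_rfl) ht ht
  exact absurd (le_of_sq_le_sq this (norm_nonneg _)) (not_le.2 hgt)

/-- A solution growing along two rays on either side of the positive real axis has zeros of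
arbitrarily large modulus near the positive real axis. -/
theorem NormalForm.exists_zero_of_tendsto (h : NormalForm g g' Q) {α : ℝ} (hα : 0 < α)
    (hα' : α < Real.pi / 2)
    (hup : Tendsto (fun t : ℝ => ‖g (t * exp ((α : ℝ) * I))‖) atTop atTop)
    (hlow : Tendsto (fun t : ℝ => ‖g (t * exp ((-α : ℝ) * I))‖) atTop atTop) (R : ℝ) :
    ∃ w ∈ slitPlane, R ≤ ‖w‖ ∧ |arg w| < 2 * α ∧ g w = 0 := by
  by_contra! hz
  have hsin : 0 < Real.sin α := Real.sin_pos_of_pos_of_lt_pi hα (by linarith [Real.pi_pos])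
  have hsin1 := Real.sin_le_one α
  -- Then `4 * δ = sin α` is exactly the decay rate of `exp (I w)` along `arg w = α`, so the error
  -- in `g' / g` cannot reverse the sign.
  set δ := Real.sin α / 4 with hδ
  obtain ⟨L, κ, hL, hκ, hexp⟩ := exists_radius_near_exponential (δ := δ) (by positivity)
    (by linarith)
  obtain ⟨R₁, hR₁, hQ⟩ := h.asymptotic κ hκ
  obtain ⟨S, hS, hsec⟩ := exists_disc_subset_sector (R := max R R₁) (by linarith : α < 2 * α)
    (by linarith) hL
  have hself : ∀ s a : ℝ, S ≤ s → |a| ≤ α → (s : ℂ) * exp (a * I) ∈ slitPlane ∧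
      g (s * exp (a * I)) ≠ 0 := by
    intro s a hs ha
    obtain ⟨h1, h2, h3⟩ := hsec s a hs ha (s * exp (a * I)) (by simpa using hL.le)
    exact ⟨h1, hz _ h1 ((le_max_left _ _).trans h2) h3⟩
  set q : ℝ × ℝ → ℂ := fun p => g' (p.1 * exp (p.2 * I)) / g (p.1 * exp (p.2 * I)) with hqdef
  have hq : ∀ s a : ℝ, S ≤ s → |a| ≤ α → ‖1 + q (s, a) ^ 2‖ ≤ δ * (1 + ‖q (s, a)‖ ^ 2) := by
    intro s a hs ha
    have hball := hsec s a hs ha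
    have := hexp g g' Q (s * exp (a * I)) (fun w hw => h.hasDerivAt w (hball w hw).1)
      (fun w hw => h.hasDerivAt_deriv w (hball w hw).1)
      (fun w hw => hQ w (hball w hw).1 ((le_max_right _ _).trans (hball w hw).2.1))
      (fun w hw => hz w (hball w hw).1 ((le_max_left _ _).trans (hball w hw).2.1) (hball w hw).2.2)
    have hne := (hself s a hs ha).2
    have hpos : 0 < ‖g (s * exp (a * I))‖ := norm_pos_iff.2 hne
    simp only [hqdef]
    have e : 1 + (g' (s * exp (a * I)) / g (s * exp (a * I))) ^ 2
        = (g (s * exp (a * I)) ^ 2 + g' (s * exp (a * I)) ^ 2) / g (s * exp (a * I)) ^ 2 := by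
      field_simp
    rw [e, norm_div, norm_div, norm_pow (g _), div_le_iff₀ (by positivity)]
    refine this.trans (le_of_eq ?_)
    field_simp
  have hcont : ContinuousOn (fun p => (q p).im) (Set.Ici S ×ˢ Set.Icc (-α) α) := by
    rintro ⟨s, a⟩ ⟨hs, ha⟩
    obtain ⟨h1, h2⟩ := hself s a hs (abs_le.2 ha)
    have hi : ContinuousAt (fun p : ℝ × ℝ => (p.1 : ℂ) * exp (p.2 * I)) (s, a) := by fun_prop
    have c1 := (h.hasDerivAt _ h1).continuousAt.comp_of_eq hi rfl
    have c2 := (h.hasDerivAt_deriv _ h1).continuousAt.comp_of_eq hi rfl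
    exact (Complex.continuous_im.continuousAt.comp (c2.div c1 h2)).continuousWithinAt
  have hpre : IsPreconnected (Set.Ici S ×ˢ Set.Icc (-α) α) :=
    ((convex_Ici S).prod (convex_Icc (-α) α)).isPreconnected
  -- `q` is never real, so on the connected parameter set the sign of its imaginary part is
  -- constant.
  have him : ∀ p ∈ Set.Ici S ×ˢ Set.Icc (-α) α, (q p).im ≠ 0 := fun p hp =>
    im_ne_zero_of_norm_one_add_sq_le (by linarith) (hq p.1 p.2 hp.1 (abs_le.2 hp.2))
  have hre : ∀ d e : ℂ, ‖d‖ = 1 → (I * d).re = -Real.sin α → ‖e - I‖ ≤ 4 * δ →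
      (e * d).re ≤ 0 := by
    intro d e hd hId he
    have h1 : e * d = I * d + (e - I) * d := by ring
    have h2 := Complex.re_le_norm ((e - I) * d)
    rw [norm_mul, hd, mul_one] at h2
    rw [h1, Complex.add_re, hId]
    linarith
  have hαα : |α| ≤ α := (abs_of_pos hα).le
  have hαα' : |-α| ≤ α := by rw [abs_neg]; exact hαα
  by_cases hsgn : ∀ p ∈ Set.Ici S ×ˢ Set.Icc (-α) α, 0 < (q p).im
  · refine h.not_tendsto_norm_atTop (S := S) (fun t ht => (hself t α ht hαα).1)
      (fun t ht => (hself t α ht hαα).2) (fun t ht => ?_) hup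
    refine hre _ _ (Complex.norm_exp_ofReal_mul_I _) ?_
      (norm_sub_I_le (by positivity) (by linarith) (hq t α ht hαα) (hsgn (t, α) ⟨ht, abs_le.1 hαα⟩))
    simp [Complex.exp_ofReal_mul_I_im]
  · push Not at hsgn
    obtain ⟨p₀, hp₀, hp₀'⟩ := hsgn
    have hneg : ∀ p ∈ Set.Ici S ×ˢ Set.Icc (-α) α, (q p).im < 0 := by
      intro p hp
      by_contra! hp'
      obtain ⟨p₁, hp₁, h0⟩ := hpre.intermediate_value hp₀ hp hcont ⟨hp₀', hp'⟩
      exact him p₁ hp₁ h0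
    refine h.not_tendsto_norm_atTop (S := S) (fun t ht => (hself t (-α) ht hαα').1)
      (fun t ht => (hself t (-α) ht hαα').2) (fun t ht => ?_) hlow
    have hq' := hq t (-α) ht hαα'
    have hm := hneg (t, -α) ⟨ht, abs_le.1 hαα'⟩
    -- When `q` is near `-I`, the same estimate applies to `-q` and the negated direction of the
    -- lower ray.
    have := hre (-exp ((-α : ℝ) * I)) (-q (t, -α))
      (by rw [norm_neg]; exact Complex.norm_exp_ofReal_mul_I _) ?_
      (norm_sub_I_le (by positivity) (by linarith) (by simpa using hq') (by simpa using hm))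
    · simpa [hqdef] using this
    · have e := Complex.exp_ofReal_mul_I_im (-α)
      rw [Real.sin_neg] at e
      simp only [mul_neg, Complex.neg_re, Complex.I_mul_re, e, neg_neg]

/-! ### The Liouville transform -/

/-- The exponent `2 / (n + 2)` of the change of variable `z = C w ^ (2 / (n + 2))`. -/
def angleRatio (P : ℂ[X]) : ℝ := 2 / ((P.natDegree : ℝ) + 2)

/-- The exponent `n / (2 (n + 2))` of the weight in the Liouville transform. -/
def weightExponent (P : ℂ[X]) : ℝ := (P.natDegree : ℝ) / (2 * ((P.natDegree : ℝ) + 2))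

/-- The modulus of the constant `C` in the change of variable. -/
def liouvilleModulus (P : ℂ[X]) : ℝ :=
  (angleRatio P ^ 2 * ‖P.leadingCoeff‖) ^ (-(1 / ((P.natDegree : ℝ) + 2)))

/-- The constant `C` in the change of variable adapted to the `j`-th critical ray. -/
def liouvilleConst (P : ℂ[X]) (j : ℤ) : ℂ := polarPoint (liouvilleModulus P) (criticalAngle P j)

/-- The weight `w ^ (n / (2 (n + 2)))`. -/
def liouvilleWeight (P : ℂ[X]) (w : ℂ) : ℂ := w ^ (weightExponent P : ℂ)

/-- The change of variable `z = C w ^ (2 / (n + 2))`. -/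
def liouvilleMap (P : ℂ[X]) (j : ℤ) (w : ℂ) : ℂ :=
  liouvilleConst P j * w / liouvilleWeight P w ^ 2

/-- The Liouville transform of `f`. -/
def liouville (P : ℂ[X]) (j : ℤ) (f : ℂ → ℂ) (w : ℂ) : ℂ :=
  liouvilleWeight P w * f (liouvilleMap P j w)

/-- The derivative of the Liouville transform. -/
def liouvilleDeriv (P : ℂ[X]) (j : ℤ) (f : ℂ → ℂ) (w : ℂ) : ℂ :=
  weightExponent P * liouvilleWeight P w / w * f (liouvilleMap P j w) +
    (1 - 2 * weightExponent P) * liouvilleConst P j / liouvilleWeight P w *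
      deriv f (liouvilleMap P j w)

/-- The potential in the equation of the Liouville transform. -/
def liouvillePotential (P : ℂ[X]) (j : ℤ) (w : ℂ) : ℂ :=
  (1 - 2 * weightExponent P) ^ 2 * liouvilleConst P j ^ 2 / liouvilleWeight P w ^ 4 *
    P.eval (liouvilleMap P j w) - weightExponent P * (weightExponent P - 1) / w ^ 2

lemma angleRatio_pos (P : ℂ[X]) : 0 < angleRatio P := by unfold angleRatio; positivity

lemma angleRatio_eq (P : ℂ[X]) : angleRatio P = 1 - 2 * weightExponent P := by
  unfold angleRatio weightExponent
  field_simp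
  ring

lemma angleRatio_mul_pi (P : ℂ[X]) : 2 * Real.pi / ((P.natDegree : ℝ) + 2) =
    angleRatio P * Real.pi := by unfold angleRatio; ring

lemma criticalAngle_add_one (P : ℂ[X]) (j : ℤ) :
    criticalAngle P (j + 1) = criticalAngle P j + angleRatio P * Real.pi := by
  unfold criticalAngle angleRatio
  push_cast
  ring

lemma leadingCoeff_ne_zero_of_natDegree_pos (hP : 1 ≤ P.natDegree) : P.leadingCoeff ≠ 0 := by
  rw [Polynomial.leadingCoeff_ne_zero]
  rintro rfl
  simp at hP

lemma liouvilleModulus_pos (hP : 1 ≤ P.natDegree) : 0 < liouvilleModulus P :=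
  Real.rpow_pos_of_pos (mul_pos (pow_pos (angleRatio_pos P) 2)
    (norm_pos_iff.2 (leadingCoeff_ne_zero_of_natDegree_pos hP))) _

lemma norm_polarPoint {r : ℝ} (hr : 0 ≤ r) (θ : ℝ) : ‖polarPoint r θ‖ = r := by
  rw [polarPoint, norm_mul, Complex.norm_exp_ofReal_mul_I, Complex.norm_real,
    Real.norm_of_nonneg hr, mul_one]

lemma norm_liouvilleConst (hP : 1 ≤ P.natDegree) (j : ℤ) :
    ‖liouvilleConst P j‖ = liouvilleModulus P :=
  norm_polarPoint (liouvilleModulus_pos hP).le _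

/-- The normalisation that makes the potential tend to `1`; its argument part is the defining
property `(n + 2) θ_j + arg p_n = 2πj` of critical rays. -/
lemma liouvilleConst_pow (hP : 1 ≤ P.natDegree) (j : ℤ) :
    (angleRatio P : ℂ) ^ 2 * P.leadingCoeff * liouvilleConst P j ^ (P.natDegree + 2) = 1 := by
  have hp := leadingCoeff_ne_zero_of_natDegree_pos hP
  have hpos : 0 < angleRatio P ^ 2 * ‖P.leadingCoeff‖ :=
    mul_pos (pow_pos (angleRatio_pos P) 2) (norm_pos_iff.2 hp)
  have h1 : liouvilleModulus P ^ (P.natDegree + 2) =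
      (angleRatio P ^ 2 * ‖P.leadingCoeff‖)⁻¹ := by
    rw [liouvilleModulus, ← Real.rpow_mul_natCast hpos.le, ← Real.rpow_neg_one]
    congr 1
    push_cast
    field_simp
  have h2 : exp (criticalAngle P j * I) ^ (P.natDegree + 2) *
      exp (arg P.leadingCoeff * I) = 1 := by
    rw [← Complex.exp_nat_mul, ← Complex.exp_add, Complex.exp_eq_one_iff]
    refine ⟨j, ?_⟩
    unfold criticalAngle
    push_cast
    have : (P.natDegree : ℂ) + 2 ≠ 0 := by exact_mod_cast (by omega : P.natDegree + 2 ≠ 0)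
    field_simp
    ring
  have h3 : P.leadingCoeff = ‖P.leadingCoeff‖ * exp (arg P.leadingCoeff * I) :=
    (Complex.norm_mul_exp_arg_mul_I _).symm
  rw [liouvilleConst, polarPoint, mul_pow, ← Complex.ofReal_pow (liouvilleModulus P), h1]
  generalize hE : exp (criticalAngle P j * I) ^ (P.natDegree + 2) = E at h2 ⊢
  have hn : (‖P.leadingCoeff‖ : ℂ) ≠ 0 := by simpa using hp
  have hs : (angleRatio P : ℂ) ≠ 0 := by exact_mod_cast (angleRatio_pos P).ne'
  push_cast
  field_simp
  nth_rw 1 [h3]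
  linear_combination (‖P.leadingCoeff‖ : ℂ) * h2

lemma liouvilleWeight_ne_zero {w : ℂ} (hw : w ≠ 0) : liouvilleWeight P w ≠ 0 := by
  rw [liouvilleWeight, Ne, Complex.cpow_eq_zero_iff]
  exact fun h => hw h.1

lemma norm_liouvilleWeight (w : ℂ) : ‖liouvilleWeight P w‖ = ‖w‖ ^ weightExponent P :=
  Complex.norm_cpow_real _ _

lemma hasDerivAt_liouvilleWeight {w : ℂ} (hw : w ∈ slitPlane) :
    HasDerivAt (liouvilleWeight P) (weightExponent P * liouvilleWeight P w / w) w := by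
  refine ((hasDerivAt_id w).cpow_const hw).congr_deriv ?_
  have hw0 := slitPlane_ne_zero hw
  rw [liouvilleWeight, id, Complex.cpow_sub _ _ hw0, Complex.cpow_one]
  ring

lemma hasDerivAt_liouvilleMap (j : ℤ) {w : ℂ} (hw : w ∈ slitPlane) :
    HasDerivAt (liouvilleMap P j)
      ((1 - 2 * weightExponent P) * liouvilleConst P j / liouvilleWeight P w ^ 2) w := by
  have hw0 := slitPlane_ne_zero hw
  have hT := liouvilleWeight_ne_zero (P := P) hw0
  refine (((hasDerivAt_id w).const_mul (liouvilleConst P j)).div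
    ((hasDerivAt_liouvilleWeight hw).pow 2) (pow_ne_zero 2 hT)).congr_deriv ?_
  simp only [id, Pi.pow_apply]
  field_simp
  push_cast
  ring

lemma hasDerivAt_liouville (hf : Differentiable ℂ f) (j : ℤ) {w : ℂ} (hw : w ∈ slitPlane) :
    HasDerivAt (liouville P j f) (liouvilleDeriv P j f w) w := by
  have hw0 := slitPlane_ne_zero hw
  have hT := liouvilleWeight_ne_zero (P := P) hw0
  have h1 := (hf (liouvilleMap P j w)).hasDerivAt.comp w (hasDerivAt_liouvilleMap j hw)
  refine ((hasDerivAt_liouvilleWeight hw).mul h1).congr_deriv ?_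
  rw [liouvilleDeriv, Function.comp]
  field_simp

/-- The weight is a constant times `(Z') ^ (-1/2)` for the change of variable `Z`, so the terms in
`f'` cancel. -/
lemma hasDerivAt_liouvilleDeriv (hf : IsNontrivialSolution P f) (j : ℤ) {w : ℂ}
    (hw : w ∈ slitPlane) :
    HasDerivAt (liouvilleDeriv P j f) (-(liouvillePotential P j w * liouville P j f w)) w := by
  have hw0 := slitPlane_ne_zero hw
  have hT := liouvilleWeight_ne_zero (P := P) hw0
  have hZ := hasDerivAt_liouvilleMap (P := P) j hw
  have h1 := (hf.differentiable (liouvilleMap P j w)).hasDerivAt.comp w hZ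
  have hd : Differentiable ℂ (deriv f) := hf.differentiable.deriv
  have h2 := (hd (liouvilleMap P j w)).hasDerivAt.comp w hZ
  have hW := hasDerivAt_liouvilleWeight (P := P) hw
  have heq : deriv (deriv f) (liouvilleMap P j w) =
      -(P.eval (liouvilleMap P j w) * f (liouvilleMap P j w)) := by
    linear_combination hf.equation (liouvilleMap P j w)
  refine (((((hW.const_mul (weightExponent P : ℂ)).div (hasDerivAt_id w) hw0)).mul h1).add
    (((hasDerivAt_const w ((1 - 2 * weightExponent P) * liouvilleConst P j)).div hW hT).mul
      h2)).congr_deriv ?_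
  rw [heq]
  simp only [liouvillePotential, liouville, Function.comp, id, Pi.div_apply]
  field_simp
  ring

lemma liouvilleWeight_pow (w : ℂ) :
    liouvilleWeight P w ^ (2 * P.natDegree + 4) = w ^ P.natDegree := by
  rw [liouvilleWeight, ← Complex.cpow_nat_mul, ← Complex.cpow_natCast]
  congr 1
  unfold weightExponent
  have : (P.natDegree : ℂ) + 2 ≠ 0 := by exact_mod_cast (by omega : P.natDegree + 2 ≠ 0)
  push_cast
  field_simp
  ring

/-- Angles are scaled by `angleRatio P`, so the slit plane opens onto the critical ray together with
its two adjacent sectors. -/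
lemma liouvilleMap_eq {w : ℂ} (hw : w ≠ 0) (j : ℤ) :
    liouvilleMap P j w = polarPoint (liouvilleModulus P * ‖w‖ ^ angleRatio P)
      (criticalAngle P j + angleRatio P * arg w) := by
  have hn : 0 < ‖w‖ := norm_pos_iff.2 hw
  have h1 : w / liouvilleWeight P w ^ 2 = exp (angleRatio P * log w) := by
    rw [liouvilleWeight, ← Complex.cpow_nat_mul, Complex.cpow_def_of_ne_zero hw, angleRatio_eq]
    nth_rw 1 [← Complex.exp_log hw]
    rw [← Complex.exp_sub]
    congr 1
    push_cast
    ring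
  have h2 : ((‖w‖ ^ angleRatio P : ℝ) : ℂ) = exp (Real.log ‖w‖ * angleRatio P) := by
    rw [Real.rpow_def_of_pos hn]
    push_cast
    rfl
  rw [liouvilleMap, mul_div_assoc, h1, liouvilleConst, polarPoint, polarPoint, Complex.ofReal_mul,
    h2, mul_assoc, mul_assoc, ← Complex.exp_add, ← Complex.exp_add, Complex.log]
  congr 2
  push_cast
  ring

lemma norm_liouvilleMap (hP : 1 ≤ P.natDegree) {w : ℂ} (hw : w ≠ 0) (j : ℤ) :
    ‖liouvilleMap P j w‖ = liouvilleModulus P * ‖w‖ ^ angleRatio P := by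
  rw [liouvilleMap_eq hw, norm_polarPoint]
  have := liouvilleModulus_pos hP
  positivity

lemma eval_eq_pow_mul_reverse (P : ℂ[X]) {z : ℂ} (hz : z ≠ 0) :
    P.eval z = z ^ P.natDegree * P.reverse.eval z⁻¹ := by
  let _ := invertibleOfNonzero hz
  have := Polynomial.eval₂_reverse_mul_pow (RingHom.id ℂ) z P
  rw [Polynomial.eval, Polynomial.eval, ← this, invOf_eq_inv, mul_comm]

/-- Writing `P(z) = z ^ n * P.reverse(1 / z)`, all powers of the weight cancel, which exhibits the
limit at infinity. -/
lemma liouvillePotential_eq (hP : 1 ≤ P.natDegree) {w : ℂ} (hw : w ≠ 0) (j : ℤ) :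
    liouvillePotential P j w = P.reverse.eval (liouvilleMap P j w)⁻¹ / P.leadingCoeff
      - weightExponent P * (weightExponent P - 1) / w ^ 2 := by
  have hT := liouvilleWeight_ne_zero (P := P) hw
  have hp := leadingCoeff_ne_zero_of_natDegree_pos hP
  have hC : liouvilleConst P j ≠ 0 := by
    rw [← norm_pos_iff, norm_liouvilleConst hP]; exact liouvilleModulus_pos hP
  have hZ : liouvilleMap P j w ≠ 0 := by
    rw [liouvilleMap]; positivity
  have hpow := liouvilleWeight_pow (P := P) w
  have hc := liouvilleConst_pow hP j
  have hσ : (1 - 2 * weightExponent P : ℂ) = angleRatio P := by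
    rw [angleRatio_eq]; push_cast; ring
  rw [liouvillePotential, eval_eq_pow_mul_reverse P hZ, hσ]
  congr 1
  have key : (angleRatio P : ℂ) ^ 2 * liouvilleConst P j ^ 2 / liouvilleWeight P w ^ 4 *
      liouvilleMap P j w ^ P.natDegree = 1 / P.leadingCoeff := by
    rw [liouvilleMap, div_pow, mul_pow, ← hpow, ← pow_mul, pow_add _ _ 4]
    rw [pow_add] at hc
    field_simp
    linear_combination
      (liouvilleWeight P w ^ 4 * liouvilleWeight P w ^ (P.natDegree * 2)) * hc
  rw [← mul_assoc, key]
  ring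

lemma normalForm_liouville (hP : 1 ≤ P.natDegree) (hf : IsNontrivialSolution P f) (j : ℤ) :
    NormalForm (liouville P j f) (liouvilleDeriv P j f) (liouvillePotential P j) where
  hasDerivAt w hw := hasDerivAt_liouville hf.differentiable j hw
  hasDerivAt_deriv w hw := hasDerivAt_liouvilleDeriv hf j hw
  asymptotic κ hκ := by
    have hp := leadingCoeff_ne_zero_of_natDegree_pos hP
    have hne : ∀ᶠ w : ℂ in comap norm atTop, w ≠ 0 := by
      filter_upwards [tendsto_comap.eventually (eventually_gt_atTop (0 : ℝ))] with w hw
      exact norm_pos_iff.1 hw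
    have hZ : Tendsto (fun w => (liouvilleMap P j w)⁻¹) (comap norm atTop) (𝓝 0) := by
      rw [tendsto_zero_iff_norm_tendsto_zero]
      have h1 : Tendsto (fun x : ℝ => (liouvilleModulus P * x ^ angleRatio P)⁻¹) atTop (𝓝 0) :=
        tendsto_inv_atTop_zero.comp
          ((tendsto_rpow_atTop (angleRatio_pos P)).const_mul_atTop (liouvilleModulus_pos hP))
      refine (h1.comp tendsto_comap).congr' ?_
      filter_upwards [hne] with w hw
      rw [norm_inv, norm_liouvilleMap hP hw, Function.comp]
    have hw2 : Tendsto (fun w : ℂ => weightExponent P * (weightExponent P - 1) / w ^ 2)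
        (comap norm atTop) (𝓝 0) := by
      have h1 : Tendsto (fun w : ℂ => w⁻¹) (comap norm atTop) (𝓝 0) := by
        rw [tendsto_zero_iff_norm_tendsto_zero]
        simp only [norm_inv]
        exact tendsto_inv_atTop_zero.comp tendsto_comap
      have := (h1.pow 2).const_mul ((weightExponent P : ℂ) * (weightExponent P - 1))
      simpa [div_eq_mul_inv] using this
    have hrev : Tendsto (fun w => P.reverse.eval (liouvilleMap P j w)⁻¹) (comap norm atTop)
        (𝓝 P.leadingCoeff) := by
      have := (P.reverse.continuous.tendsto 0).comp hZ
      rwa [← Polynomial.coeff_zero_eq_eval_zero, Polynomial.coeff_zero_reverse] at this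
    have hlim : Tendsto (liouvillePotential P j) (comap norm atTop) (𝓝 1) := by
      have := (hrev.div_const P.leadingCoeff).sub hw2
      rw [div_self hp, sub_zero] at this
      refine this.congr' ?_
      filter_upwards [hne] with w hw
      rw [liouvillePotential_eq hP hw]
    obtain ⟨R, hR⟩ := eventually_atTop.1 (eventually_comap.1
      (hlim.eventually (Metric.closedBall_mem_nhds 1 hκ)))
    refine ⟨max R 1, by positivity, fun w _ hw => ?_⟩
    have := hR ‖w‖ ((le_max_left _ _).trans hw) w rfl
    rwa [dist_eq_norm] at this

/-! ### Transfer of zeros, growth and decay to the transform -/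

lemma finite_zeros_closedBall (hf : IsNontrivialSolution P f) (R : ℝ) :
    {z ∈ Metric.closedBall (0 : ℂ) R | f z = 0}.Finite := by
  obtain ⟨x, hx⟩ := hf.nontrivial
  have han : AnalyticOnNhd ℂ f Set.univ :=
    (Complex.analyticOnNhd_univ_iff_differentiable).2 hf.differentiable
  have h := codiscreteWithin_mono (Set.subset_univ (Metric.closedBall (0 : ℂ) R))
    (han.preimage_zero_mem_codiscrete hx)
  refine ((isCompact_closedBall (0 : ℂ) R).finite_sdiff_of_mem_codiscreteWithin h).subset ?_
  rintro z ⟨hz, h0⟩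
  exact ⟨hz, by simpa using h0⟩

/-- Otherwise a segment of the ray would put infinitely many zeros in one ball. -/
lemma frequently_ne_zero_on_ray (hf : IsNontrivialSolution P f) (θ : ℝ) :
    ∃ᶠ r : ℝ in atTop, f (polarPoint r θ) ≠ 0 := by
  intro h
  obtain ⟨r₀, hr₀⟩ := eventually_atTop.1 h
  set s := max r₀ 0 with hs
  have hinj : Set.InjOn (fun r : ℝ => polarPoint r θ) (Set.Icc s (s + 1)) := by
    intro a ha b hb hab
    have h0 : 0 ≤ s := le_max_right _ _
    have := congrArg norm hab
    simpa [norm_polarPoint (h0.trans ha.1), norm_polarPoint (h0.trans hb.1)] using this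
  refine (Set.Icc_infinite (lt_add_one s)).image hinj
    ((finite_zeros_closedBall hf (s + 1)).subset ?_)
  rintro _ ⟨r, hr, rfl⟩
  have h0 : 0 ≤ s := le_max_right _ _
  refine ⟨by simpa [norm_polarPoint (h0.trans hr.1)] using hr.2, ?_⟩
  have := hr₀ r ((le_max_left _ _).trans hr.1)
  exact not_not.1 this

lemma BlowsUpOnRay.eventually_one_lt {n : ℕ} {θ : ℝ} (h : BlowsUpOnRay n f θ) :
    ∀ᶠ r : ℝ in atTop, 1 < ‖f (polarPoint r θ)‖ := by
  filter_upwards [eventually_lt_of_lt_liminf h, eventually_gt_atTop 0] with r hr hr0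
  have hpos : 0 < r ^ (-(((n : ℝ) + 2) / 2)) := Real.rpow_pos_of_pos hr0 _
  by_contra! hle
  have : ENNReal.log ‖f (polarPoint r θ)‖ₑ ≤ 0 := by
    rw [← ENNReal.log_one]
    refine ENNReal.log_monotone ?_
    rw [← ofReal_norm]
    exact ENNReal.ofReal_le_one.2 hle
  refine absurd hr (not_lt.2 ?_)
  exact mul_nonpos_of_nonneg_of_nonpos (by exact_mod_cast hpos.le) this

lemma DecaysOnRay.exists_eventually_le_exp {n : ℕ} {θ : ℝ} (h : DecaysOnRay n f θ) :
    ∃ b : ℝ, 0 < b ∧ ∀ᶠ r : ℝ in atTop,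
      ‖f (polarPoint r θ)‖ ≤ Real.exp (-(b * r ^ (((n : ℝ) + 2) / 2))) := by
  obtain ⟨b, hb0, hb⟩ := EReal.lt_iff_exists_real_btwn.1 h
  refine ⟨b, by exact_mod_cast hb0, ?_⟩
  filter_upwards [eventually_lt_of_lt_liminf hb, eventually_gt_atTop 0] with r hr hr0
  by_cases hf0 : f (polarPoint r θ) = 0
  · rw [hf0, norm_zero]; positivity
  have hn : 0 < ‖f (polarPoint r θ)‖ := norm_pos_iff.2 hf0
  rw [ENNReal.log_inv, ENNReal.log_pos_real (by simpa using hf0) (by simp), toReal_enorm] at hr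
  have hr' : b < r ^ (-(((n : ℝ) + 2) / 2)) * -Real.log ‖f (polarPoint r θ)‖ := by
    exact_mod_cast hr
  rw [← Real.log_le_iff_le_exp hn]
  rw [Real.rpow_neg hr0.le, inv_mul_eq_div, lt_div_iff₀ (Real.rpow_pos_of_pos hr0 _)] at hr'
  linarith

lemma arg_ofReal_mul_exp {s a : ℝ} (hs : 0 < s) (ha : |a| < Real.pi) :
    arg (s * exp (a * I)) = a := by
  obtain ⟨h1, h2⟩ := abs_lt.1 ha
  rw [Complex.arg_real_mul _ hs, Complex.arg_exp_mul_I, toIocMod_eq_self]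
  constructor <;> linarith

lemma norm_ofReal_mul_exp {s : ℝ} (hs : 0 ≤ s) (a : ℝ) : ‖(s : ℂ) * exp (a * I)‖ = s :=
  norm_polarPoint hs a

lemma ofReal_mul_exp_ne_zero {s : ℝ} (hs : 0 < s) (a : ℝ) : (s : ℂ) * exp (a * I) ≠ 0 := by
  rw [← norm_pos_iff, norm_ofReal_mul_exp hs.le]; exact hs

lemma liouvilleMap_polar (j : ℤ) {s a : ℝ} (hs : 0 < s) (ha : |a| < Real.pi) :
    liouvilleMap P j (s * exp (a * I)) = polarPoint (liouvilleModulus P * s ^ angleRatio P)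
      (criticalAngle P j + angleRatio P * a) := by
  rw [liouvilleMap_eq (ofReal_mul_exp_ne_zero hs a), norm_ofReal_mul_exp hs.le,
    arg_ofReal_mul_exp hs ha]

lemma norm_liouville_polar (j : ℤ) {s a : ℝ} (hs : 0 < s) (ha : |a| < Real.pi) :
    ‖liouville P j f (s * exp (a * I))‖ = s ^ weightExponent P *
      ‖f (polarPoint (liouvilleModulus P * s ^ angleRatio P)
        (criticalAngle P j + angleRatio P * a))‖ := by
  rw [liouville, norm_mul, norm_liouvilleWeight, norm_ofReal_mul_exp hs.le,
    liouvilleMap_polar j hs ha]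

lemma tendsto_modulus_atTop (hP : 1 ≤ P.natDegree) :
    Tendsto (fun s : ℝ => liouvilleModulus P * s ^ angleRatio P) atTop atTop :=
  (tendsto_rpow_atTop (angleRatio_pos P)).const_mul_atTop (liouvilleModulus_pos hP)

lemma weightExponent_pos (hP : 1 ≤ P.natDegree) : 0 < weightExponent P := by
  have : (0 : ℝ) < P.natDegree := by exact_mod_cast hP
  unfold weightExponent
  positivity

/-- Eventually `‖f‖ > 1` suffices, since the weight has a positive exponent and itself tends to
infinity. -/
lemma tendsto_norm_liouville_atTop (hP : 1 ≤ P.natDegree) (j : ℤ) {a : ℝ} (ha : |a| < Real.pi)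
    (h : BlowsUpOnRay P.natDegree f (criticalAngle P j + angleRatio P * a)) :
    Tendsto (fun s : ℝ => ‖liouville P j f (s * exp (a * I))‖) atTop atTop := by
  refine tendsto_atTop_mono' atTop ?_ (tendsto_rpow_atTop (weightExponent_pos hP))
  filter_upwards [(tendsto_modulus_atTop hP).eventually h.eventually_one_lt,
    eventually_gt_atTop 0] with s hs hs0
  rw [norm_liouville_polar j hs0 ha]
  exact le_mul_of_one_le_right (by positivity) hs.le

lemma tendsto_liouville_zero (hP : 1 ≤ P.natDegree) (j : ℤ) {a : ℝ} (ha : |a| < Real.pi)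
    (h : DecaysOnRay P.natDegree f (criticalAngle P j + angleRatio P * a)) :
    Tendsto (fun s : ℝ => liouville P j f (s * exp (a * I))) atTop (𝓝 0) := by
  obtain ⟨b, hb, hdec⟩ := h.exists_eventually_le_exp
  have hc := liouvilleModulus_pos hP
  set B := b * liouvilleModulus P ^ (((P.natDegree : ℝ) + 2) / 2) with hB
  have hB0 : 0 < B := mul_pos hb (Real.rpow_pos_of_pos hc _)
  refine squeeze_zero_norm' ?_
    (tendsto_rpow_mul_exp_neg_mul_atTop_nhds_zero (weightExponent P) B hB0)
  filter_upwards [(tendsto_modulus_atTop hP).eventually hdec, eventually_gt_atTop 0] with s hs hs0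
  rw [norm_liouville_polar j hs0 ha]
  -- The order `(n + 2) / 2` becomes order one in `w`, so decay like `exp (-B s)` beats the power
  -- weight.
  have hr : angleRatio P * (((P.natDegree : ℝ) + 2) / 2) = 1 := by unfold angleRatio; field_simp
  have e : -(b * (liouvilleModulus P * s ^ angleRatio P) ^ (((P.natDegree : ℝ) + 2) / 2))
      = -B * s := by
    rw [Real.mul_rpow hc.le (by positivity), ← Real.rpow_mul hs0.le, hr, Real.rpow_one, hB]
    ring
  rw [e] at hs
  gcongr

lemma frequently_liouville_ne_zero (hP : 1 ≤ P.natDegree) (hf : IsNontrivialSolution P f) (j : ℤ)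
    {a : ℝ} (ha : |a| < Real.pi) :
    ∃ᶠ s : ℝ in atTop, liouville P j f (s * exp (a * I)) ≠ 0 := by
  intro h
  refine frequently_ne_zero_on_ray hf (criticalAngle P j + angleRatio P * a) ?_
  have hc := liouvilleModulus_pos hP
  have hσ := angleRatio_pos P
  have ht : Tendsto (fun r : ℝ => (r / liouvilleModulus P) ^ (angleRatio P)⁻¹) atTop atTop :=
    (tendsto_rpow_atTop (inv_pos.2 hσ)).comp (tendsto_id.atTop_div_const hc)
  filter_upwards [ht.eventually h, eventually_gt_atTop 0] with r hr hr0
  rw [not_not] at hr ⊢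
  have hs : 0 < (r / liouvilleModulus P) ^ (angleRatio P)⁻¹ := by positivity
  have hn := norm_liouville_polar (P := P) (f := f) j hs ha
  rw [hr, norm_zero, Real.rpow_inv_rpow (by positivity) hσ.ne', mul_div_cancel₀ _ hc.ne',
    eq_comm, mul_eq_zero] at hn
  exact norm_eq_zero.1 (hn.resolve_left (by positivity))

/-- Zeros of the Liouville transform correspond to zeros of `f`. -/
lemma exists_liouville_eq_zero (hP : 1 ≤ P.natDegree) (j : ℤ) {r θ : ℝ} (hr : 0 < r)
    (hθ : |θ - criticalAngle P j| < angleRatio P * Real.pi) (h0 : f (polarPoint r θ) = 0) :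
    ∃ w ∈ slitPlane, arg w = (θ - criticalAngle P j) / angleRatio P ∧
      liouvilleModulus P * ‖w‖ ^ angleRatio P = r ∧ liouville P j f w = 0 := by
  have hc := liouvilleModulus_pos hP
  have hσ := angleRatio_pos P
  set a := (θ - criticalAngle P j) / angleRatio P with ha
  have ha' : |a| < Real.pi := by
    rw [ha, abs_div, abs_of_pos hσ, div_lt_iff₀ hσ]; linarith
  set s := (r / liouvilleModulus P) ^ (angleRatio P)⁻¹ with hs
  have hs0 : 0 < s := by positivity
  have hr' : liouvilleModulus P * s ^ angleRatio P = r := by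
    rw [hs, Real.rpow_inv_rpow (by positivity) hσ.ne', mul_div_cancel₀ _ hc.ne']
  refine ⟨s * exp (a * I), ?_, arg_ofReal_mul_exp hs0 ha', ?_, ?_⟩
  · rw [Complex.mem_slitPlane_iff_arg, arg_ofReal_mul_exp hs0 ha']
    exact ⟨(abs_lt.1 ha').2.ne, ofReal_mul_exp_ne_zero hs0 a⟩
  · rw [norm_ofReal_mul_exp hs0.le, hr']
  · have hθ' : criticalAngle P j + angleRatio P * a = θ := by rw [ha]; field_simp; ring
    rw [liouville, liouvilleMap_polar j hs0 ha', hr', hθ', h0, mul_zero]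

lemma isShortageRay_of_zero_free (hP : 1 ≤ P.natDegree) (hf : IsNontrivialSolution P f) (j : ℤ)
    {ε R : ℝ} (hε : ε < angleRatio P * Real.pi)
    (h : ∀ w ∈ slitPlane, R ≤ ‖w‖ → |arg w| ≤ ε / angleRatio P → liouville P j f w ≠ 0) :
    IsShortageRay P f j ε := by
  have hc := liouvilleModulus_pos hP
  have hσ := angleRatio_pos P
  refine (finite_zeros_closedBall hf (liouvilleModulus P * (max R 0) ^ angleRatio P)).subset ?_
  rintro z ⟨⟨r, θ, hr, hθ, rfl⟩, h0⟩
  refine ⟨?_, h0⟩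
  obtain ⟨w, hw, harg, hnorm, hz⟩ := exists_liouville_eq_zero hP j hr (hθ.trans hε) h0
  rw [mem_closedBall_zero_iff, norm_polarPoint hr.le, ← hnorm]
  have hlt : ‖w‖ < R := by
    by_contra! hR
    refine h w hw hR ?_ hz
    rw [harg, abs_div, abs_of_pos hσ]
    gcongr
  have := hlt.le.trans (le_max_left R 0)
  gcongr

/-- Converts an angular bound into the margin `s` from the negative axis used in
`NormalForm.zero_free_of_tendsto`. -/
lemma neg_mul_norm_le_re {w : ℂ} {β : ℝ} (hβ : β ≤ Real.pi) (hw : |arg w| ≤ β) :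
    -(1 - min 1 (1 + Real.cos β)) * ‖w‖ ≤ w.re := by
  have h1 : Real.cos β ≤ Real.cos (arg w) := by
    rw [← Real.cos_abs (arg w)]
    exact Real.cos_le_cos_of_nonneg_of_le_pi (abs_nonneg _) hβ hw
  rw [← Complex.norm_mul_cos_arg w, mul_comm]
  gcongr
  linarith [min_le_right 1 (1 + Real.cos β)]

lemma min_one_add_cos_pos {β : ℝ} (h0 : 0 ≤ β) (hβ : β < Real.pi) :
    0 < min 1 (1 + Real.cos β) := by
  refine lt_min one_pos ?_
  have := Real.cos_lt_cos_of_nonneg_of_le_pi h0 le_rfl hβ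
  rw [Real.cos_pi] at this
  linarith

lemma exp_pi_div_two_mul_I : exp ((Real.pi / 2 : ℝ) * I) = I := by
  push_cast
  exact Complex.exp_pi_div_two_mul_I

lemma exp_neg_pi_div_two_mul_I : exp ((-(Real.pi / 2) : ℝ) * I) = -I := by
  push_cast
  rw [neg_mul, Complex.exp_neg, Complex.exp_pi_div_two_mul_I, Complex.inv_I]

lemma abs_pi_div_two_lt : |Real.pi / 2| < Real.pi := by
  rw [abs_of_pos (by positivity)]; linarith [Real.pi_pos]

/-! ### Shortage and non-shortage of critical rays -/

theorem isShortageRay_of_decays_above (hP : 1 ≤ P.natDegree) (hf : IsNontrivialSolution P f)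
    (j : ℤ) {ε : ℝ} (hε0 : 0 < ε) (hε : ε < angleRatio P * Real.pi)
    (h : DecaysOnRay P.natDegree f (criticalAngle P j + angleRatio P * (Real.pi / 2))) :
    IsShortageRay P f j ε := by
  have hσ := angleRatio_pos P
  have hβ : ε / angleRatio P < Real.pi := by rw [div_lt_iff₀ hσ]; linarith
  have hlim := tendsto_liouville_zero hP j abs_pi_div_two_lt h
  have hne := frequently_liouville_ne_zero hP hf j abs_pi_div_two_lt
  simp only [exp_pi_div_two_mul_I] at hlim hne
  obtain ⟨R, hR⟩ := (normalForm_liouville hP hf j).zero_free_of_tendsto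
    (min_one_add_cos_pos (by positivity) hβ) (min_le_left _ _) hlim hne
  exact isShortageRay_of_zero_free hP hf j hε
    fun w hw hwR harg => hR w hw hwR (neg_mul_norm_le_re hβ.le harg)

theorem isShortageRay_of_decays_below (hP : 1 ≤ P.natDegree) (hf : IsNontrivialSolution P f)
    (j : ℤ) {ε : ℝ} (hε0 : 0 < ε) (hε : ε < angleRatio P * Real.pi)
    (h : DecaysOnRay P.natDegree f (criticalAngle P j + angleRatio P * (-(Real.pi / 2)))) :
    IsShortageRay P f j ε := by
  have hσ := angleRatio_pos P
  have hβ : ε / angleRatio P < Real.pi := by rw [div_lt_iff₀ hσ]; linarith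
  have hπ : |-(Real.pi / 2)| < Real.pi := by rw [abs_neg]; exact abs_pi_div_two_lt
  have hlim := tendsto_liouville_zero hP j hπ h
  have hne := frequently_liouville_ne_zero hP hf j hπ
  simp only [exp_neg_pi_div_two_mul_I] at hlim hne
  have hlim' : Tendsto (fun t : ℝ => (conj ∘ liouville P j f ∘ conj) (t * I)) atTop (𝓝 0) := by
    simpa [Function.comp_def] using (Complex.continuous_conj.tendsto 0).comp hlim
  obtain ⟨R, hR⟩ := (normalForm_liouville hP hf j).conj.zero_free_of_tendsto
    (min_one_add_cos_pos (by positivity) hβ) (min_le_left _ _) hlim' (by simpa using hne)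
  refine isShortageRay_of_zero_free (R := R) hP hf j hε fun w hw hwR harg h0 => ?_
  refine hR (conj w) (by simpa [mem_slitPlane_iff] using hw) (by simpa using hwR) ?_ (by simp [h0])
  simpa using neg_mul_norm_le_re hβ.le harg

theorem not_isShortageRay_of_blowsUp (hP : 1 ≤ P.natDegree) (hf : IsNontrivialSolution P f)
    (j : ℤ) (h₁ : BlowsUpOnSector P f (j - 1)) (h₂ : BlowsUpOnSector P f j) {ε : ℝ} (hε : 0 < ε) :
    ¬ IsShortageRay P f j ε := by
  intro hfin
  have hσ := angleRatio_pos P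
  have hπ := Real.pi_pos
  -- The first bound sends `|arg w| < 2 * α` into `W_j(ε)`; the second keeps `α < π / 2`.
  set α := min (ε / (2 * angleRatio P)) (Real.pi / 4) with hα
  have hα0 : 0 < α := by positivity
  have hα4 : α ≤ Real.pi / 4 := min_le_right _ _
  have hαε : angleRatio P * (2 * α) ≤ ε := by
    have : α ≤ ε / (2 * angleRatio P) := min_le_left _ _
    rw [le_div_iff₀ (by positivity)] at this
    linarith
  have hαπ : |α| < Real.pi := by rw [abs_of_pos hα0]; linarith
  have hlt : angleRatio P * α < angleRatio P * Real.pi := by gcongr; linarith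
  have hpos : 0 < angleRatio P * α := by positivity
  have hup := tendsto_norm_liouville_atTop hP j hαπ
    (h₂ _ ⟨by linarith, by rw [criticalAngle_add_one]; linarith⟩)
  have hprev := criticalAngle_add_one P (j - 1)
  rw [sub_add_cancel] at hprev
  have hlow := tendsto_norm_liouville_atTop (f := f) hP j (a := -α) (by rwa [abs_neg])
    (h₁ _ ⟨by linarith, by rw [sub_add_cancel]; linarith⟩)
  obtain ⟨R, hR⟩ := hfin.isBounded.exists_norm_le
  obtain ⟨S, hS⟩ := eventually_atTop.1 ((tendsto_modulus_atTop hP).eventually_gt_atTop R)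
  obtain ⟨w, hw, hwS, harg, h0⟩ := (normalForm_liouville hP hf j).exists_zero_of_tendsto hα0
    (by linarith) hup hlow S
  have hw0 := slitPlane_ne_zero hw
  have hz : f (liouvilleMap P j w) = 0 :=
    (mul_eq_zero.1 h0).resolve_left (liouvilleWeight_ne_zero hw0)
  have hbig := hS _ hwS
  rw [← norm_liouvilleMap hP hw0 j] at hbig
  refine absurd (hR _ ⟨⟨_, _, ?_, ?_, liouvilleMap_eq hw0 j⟩, hz⟩) (not_le.2 hbig)
  · have := liouvilleModulus_pos hP
    positivity
  · rw [add_sub_cancel_left, abs_mul, abs_of_pos hσ]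
    exact (mul_lt_mul_of_pos_left harg hσ).trans_le hαε

end PolyOsc

end

theorem theorem3 (P : Polynomial ℂ) (hP : 1 ≤ P.natDegree) (f : ℂ → ℂ)
    (hf : PolyOsc.IsNontrivialSolution P f) :
    (∀ j : ℤ, PolyOsc.BlowsUpOnSector P f (j - 1) → PolyOsc.BlowsUpOnSector P f j →
      ∀ ε : ℝ, 0 < ε → ¬ PolyOsc.IsShortageRay P f j ε) ∧
    (∀ j : ℤ, PolyOsc.DecaysOnSector P f j →
      ∀ ε : ℝ, 0 < ε → ε < 2 * Real.pi / ((P.natDegree : ℝ) + 2) →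
        PolyOsc.IsShortageRay P f j ε ∧ PolyOsc.IsShortageRay P f (j + 1) ε) := by
  refine ⟨fun j h₁ h₂ ε hε => PolyOsc.not_isShortageRay_of_blowsUp hP hf j h₁ h₂ hε,
    fun j h ε hε0 hε => ?_⟩
  rw [PolyOsc.angleRatio_mul_pi] at hε
  have hpos : 0 < PolyOsc.angleRatio P * Real.pi := mul_pos (PolyOsc.angleRatio_pos P) Real.pi_pos
  have hnext := PolyOsc.criticalAngle_add_one P j
  -- Only the bisecting ray of the sector is used: it is the positive imaginary axis seen from `θ_j`
  -- and the negative one seen from `θ_{j+1}`.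
  refine ⟨PolyOsc.isShortageRay_of_decays_above hP hf j hε0 hε (h _ ⟨?_, ?_⟩),
    PolyOsc.isShortageRay_of_decays_below hP hf (j + 1) hε0 hε (h _ ⟨?_, ?_⟩)⟩ <;> linarith
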